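/- Let $\mathcal{E}$ be a locally cartesian closed category (with a terminal object $*$), with a choice of pullback functors $p^*$ and of right adjoints $p_*$ of $p^*$, for all arrows $p$, and let $\mathbb{I}$ be an object of $\mathcal{E}$. *Notation.* Let $\mathcal{E}^{\mathbf 2}_{\mathrm{cart}}$, $\mathcal{E}^{\mathbf 3}_{\mathrm{cart}}$, $\mathcal{E}^{\mathbf 4}_{\mathrm{cart}}$ be the categories of arrows, composable pairs and composable triples of arrows of $\mathcal{E}$, with the natural transformations all of whose squares are pullbacks as morphisms. Let $\mathrm{ev}_{01}$ be the functor that takes the first arrow of a composable pair or triple. By the Beck–Chevalley condition, pushforward defines functors $\Pi\colon \mathcal{E}^{\mathbf 4}_{\mathrm{cart}} \to \mathcal{E}^{\mathbf 3}_{\mathrm{cart}}$, $(r,q,p) \mapsto (p_*r, p_*q)$, and $\Pi\colon \mathcal{E}^{\mathbf 3}_{\mathrm{cart}} \to \mathcal{E}^{\mathbf 2}_{\mathrm{cart}}$, $(q,p)\mapsto p_*q$. Let $\mathcal{E}^{\mathbb R}_{\mathrm{cart}}$ be the category of arrows with a specified section, with the pullback squares that commute with the sections as morphisms. Let $\mathcal{E}^{\mathbf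 2\times\mathbb R}_{\mathrm{cart}}$ be the category of retract diagrams in the arrow category of $\mathcal{E}$, with the natural transformations that are pullback squares at the center arrow and at the retract arrow as morphisms, and let $\mathrm{ev}_c, \mathrm{ev}_r\colon \mathcal{E}^{\mathbf 2\times\mathbb R}_{\mathrm{cart}} \to \mathcal{E}^{\mathbf 2}_{\mathrm{cart}}$ be the evaluations at the center and at the retract. For $p\colon A\to X$, let $\delta\Rightarrow p\colon A^{\mathbb I}\times\mathbb I \to A_\epsilon$ be the map induced by $\epsilon\colon A^{\mathbb I}\times\mathbb I\to A$ and $p^{\mathbb I}\times\mathbb I$ into the pullback $A_\epsilon$ of $p$ along the evaluation $\epsilon\colon X^{\mathbb I}\times\mathbb I\to X$; this defines a functor $\delta\Rightarrow(-)\colon\mathcal{E}^{\mathbf 2}_{\mathrm{cart}}\to\mathcal{E}^{\mathbf 2}_{\mathrm{cart}}$. All fibre products of categories are strict. *Hypotheses.* Let $u\colon \mathbf{TFib}\to\mathcal{E}^{\mathbf 2}$ be a functor such that - (TF0) $u$ is a fibred notion of structure: $\mathrm{cod}\cdot u\colon\mathbf{TFib}\to\mathcal{E}$ is a Grothendieck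 fibration, $u$ is a cartesian functor from $\mathrm{cod}\cdot u$ to $\mathrm{cod}$, and the restriction $u\colon\mathbf{TFib}_{\mathrm{cart}}\to\mathcal{E}^{\mathbf 2}_{\mathrm{cart}}$ to cartesian arrows is a discrete fibration; - (TF1) there is a functor $s\colon \mathbf{TFib}_{\mathrm{cart}}\to\mathcal{E}^{\mathbb R}_{\mathrm{cart}}$ over $\mathcal{E}^{\mathbf 2}_{\mathrm{cart}}$; - (TF2) $\Pi\colon \mathcal{E}^{\mathbf 4}_{\mathrm{cart}} \to \mathcal{E}^{\mathbf 3}_{\mathrm{cart}}$ lifts to a functor from the pullback of $u\colon\mathbf{TFib}_{\mathrm{cart}}\to\mathcal{E}^{\mathbf 2}_{\mathrm{cart}}$ and $\mathrm{ev}_{01}\colon\mathcal{E}^{\mathbf 4}_{\mathrm{cart}}\to\mathcal{E}^{\mathbf 2}_{\mathrm{cart}}$ to the pullback of $u$ and $\mathrm{ev}_{01}\colon\mathcal{E}^{\mathbf 3}_{\mathrm{cart}}\to\mathcal{E}^{\mathbf 2}_{\mathrm{cart}}$; - (TF3) $\mathrm{ev}_r$ lifts to a functor from the pullback of $u\colon\mathbf{TFib}_{\mathrm{cart}}\to\mathcal{E}^{\mathbf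 2}_{\mathrm{cart}}$ and $\mathrm{ev}_c$ to $\mathbf{TFib}_{\mathrm{cart}}$. *Conclusion.* Let $u\colon\mathbf{Fib}_{\mathrm{cart}}\to\mathcal{E}^{\mathbf 2}_{\mathrm{cart}}$ be the pullback of $u\colon\mathbf{TFib}_{\mathrm{cart}}\to\mathcal{E}^{\mathbf 2}_{\mathrm{cart}}$ along $\delta\Rightarrow(-)$, and let $\mathbf{Fib}_{\mathrm{cart}}\times_{\mathcal{E}}\mathbf{Fib}_{\mathrm{cart}}$ be the category of composable pairs $(q,p)$ of objects of $\mathbf{Fib}_{\mathrm{cart}}$, with its functor $u\times u$ to $\mathcal{E}^{\mathbf 3}_{\mathrm{cart}}$. Then $u\colon\mathbf{Fib}_{\mathrm{cart}}\to\mathcal{E}^{\mathbf 2}_{\mathrm{cart}}$ is a discrete fibration; $\mathbf{Fib}_{\mathrm{cart}}$ and $\mathbf{Fib}_{\mathrm{cart}}\times_{\mathcal{E}}\mathbf{Fib}_{\mathrm{cart}}$ are Grothendieck fibrations over $\mathcal{E}$ by means of the codomain (of $p$, for a pair $(q,p)$); and there is a functor $\widetilde\Pi\colon\mathbf{Fib}_{\mathrm{cart}}\times_{\mathcal{E}}\mathbf{Fib}_{\mathrm{cart}}\to\mathbf{Fib}_{\mathrm{cart}}$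 with $u\cdot\widetilde\Pi=\Pi\cdot(u\times u)$ that is a cartesian functor over $\mathcal{E}$. -/

import Mathlib

open CategoryTheory Limits

namespace StructuredFrobenius

universe v u v₁ v₂ v₃ u₁ u₂ u₃

/-! ### Fibrations, cartesian functors, discrete fibrations, strict pullbacks of categories -/

section Fibrations

variable {𝒮 : Type u} [Category.{v} 𝒮]
variable {𝒳 : Type u₁} [Category.{v₁} 𝒳] {𝒴 : Type u₂} [Category.{v₂} 𝒴]

/-- The arrows of `𝒳` that are cartesian with respect to `p : 𝒳 ⥤ 𝒮`. -/
def cartesianArrows (p : 𝒳 ⥤ 𝒮) : MorphismProperty 𝒳 :=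
  fun _ _ φ => p.IsStronglyCartesian (p.map φ) φ

instance (p : 𝒳 ⥤ 𝒮) : (cartesianArrows p).IsMultiplicative where
  id_mem X := by
    have : p.IsStronglyCartesian (𝟙 (p.obj X)) (𝟙 X) := inferInstance
    simpa [cartesianArrows] using this
  comp_mem f g hf hg := by
    have h₁ : p.IsStronglyCartesian (p.map f) f := hf
    have h₂ : p.IsStronglyCartesian (p.map g) g := hg
    have : p.IsStronglyCartesian (p.map f ≫ p.map g) (f ≫ g) := inferInstance
    simpa [cartesianArrows] using this

/-- The wide subcategory of cartesian arrows. -/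
abbrev Cart (p : 𝒳 ⥤ 𝒮) := WideSubcategory (cartesianArrows p)

/-- `F` is a cartesian functor from `p : 𝒳 ⥤ 𝒮` to `q : 𝒴 ⥤ 𝒮`: it is a functor over `𝒮` that
preserves cartesian arrows. -/
structure IsCartesianFunctor (p : 𝒳 ⥤ 𝒮) (q : 𝒴 ⥤ 𝒮) (F : 𝒳 ⥤ 𝒴) : Prop where
  comm : F ⋙ q = p
  map_cartesian : ∀ {X Y : 𝒳} (φ : X ⟶ Y), cartesianArrows p φ → cartesianArrows q (F.map φ)

/-- `F` is a discrete fibration: each arrow `f : b ⟶ F d` has exactly one lift with codomain `d`. -/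
def IsDiscreteFibration (F : 𝒳 ⥤ 𝒴) : Prop :=
  ∀ (d : 𝒳) (b : 𝒴) (f : b ⟶ F.obj d), ∃! e : Σ d' : 𝒳, (d' ⟶ d), F.IsHomLift f e.2

end Fibrations

section StrictPullback

variable {𝒜 : Type u₁} [Category.{v₁} 𝒜] {ℬ : Type u₂} [Category.{v₂} ℬ]
variable {𝒞 : Type u₃} [Category.{v₃} 𝒞]

/-- The objects of the (strict) pullback `𝒜 ×_𝒞 ℬ` of categories. -/
structure StrictPullback (F : 𝒜 ⥤ 𝒞) (G : ℬ ⥤ 𝒞) where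
  fst : 𝒜
  snd : ℬ
  w : F.obj fst = G.obj snd

namespace StrictPullback

variable {F : 𝒜 ⥤ 𝒞} {G : ℬ ⥤ 𝒞}

/-- Arrows of `𝒜 ×_𝒞 ℬ`: pairs of arrows with the same image in `𝒞`. -/
@[ext]
structure Hom (X Y : StrictPullback F G) where
  fst : X.fst ⟶ Y.fst
  snd : X.snd ⟶ Y.snd
  w : F.map fst ≫ eqToHom Y.w = eqToHom X.w ≫ G.map snd

instance : Category (StrictPullback F G) where
  Hom X Y := Hom X Y
  id X := ⟨𝟙 _, 𝟙 _, by simp⟩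
  comp f g := ⟨f.fst ≫ g.fst, f.snd ≫ g.snd, by
    rw [F.map_comp, G.map_comp, Category.assoc, g.w, ← Category.assoc, f.w, Category.assoc]⟩
  id_comp f := by apply Hom.ext <;> simp
  comp_id f := by apply Hom.ext <;> simp
  assoc f g h := by apply Hom.ext <;> simp

variable (F G)

/-- The first projection. -/
def π₁ : StrictPullback F G ⥤ 𝒜 where
  obj X := X.fst
  map f := Hom.fst f

/-- The second projection. -/
def π₂ : StrictPullback F G ⥤ ℬ where
  obj X := X.snd
  map f := Hom.snd f

end StrictPullback

end StrictPullback

/-! ### Diagrams and pullback squares -/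

section Diagrams

variable (C : Type u) [Category.{v} C]

/-- The commutative squares (arrows of the arrow category) that are pullback squares. -/
def pullbackSquares : MorphismProperty (Arrow C) :=
  fun f g φ => IsPullback φ.left f.hom g.hom φ.right

instance : (pullbackSquares C).IsMultiplicative where
  id_mem f := IsPullback.of_horiz_isIso ⟨by simp⟩
  comp_mem _ _ hf hg := IsPullback.paste_horiz hf hg

/-- Arrows of `C` and pullback squares. -/
abbrev CartArrow := WideSubcategory (pullbackSquares C)

variable {C} in
/-- An arrow of `C`, as an object of `CartArrow C`. -/
abbrev CartArrow.of {A X : C} (p : A ⟶ X) : CartArrow C := ⟨Arrow.mk p⟩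

variable {C} in
/-- A pullback square, as an arrow of `CartArrow C`. -/
abbrev CartArrow.homOf {A X A' X' : C} {p' : A' ⟶ X'} {p : A ⟶ X} {a : A' ⟶ A} {x : X' ⟶ X}
    (h : IsPullback a p' p x) : CartArrow.of p' ⟶ CartArrow.of p :=
  ⟨Arrow.homMk a x h.w, h⟩

/-- The codomain functor on arrows and pullback squares. -/
def CartArrow.cod : CartArrow C ⥤ C := wideSubcategoryInclusion _ ⋙ Arrow.rightFunc

/-- Composable pairs `B ⟶ A ⟶ X`, and natural transformations all of whose squares are pullbacks
between them. -/
structure CartPair where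
  {B A X : C}
  q : B ⟶ A
  p : A ⟶ X

namespace CartPair

variable {C}

@[ext]
structure Hom (S T : CartPair C) where
  b : S.B ⟶ T.B
  a : S.A ⟶ T.A
  x : S.X ⟶ T.X
  isPullback_q : IsPullback b S.q T.q a
  isPullback_p : IsPullback a S.p T.p x

instance : Category (CartPair C) where
  Hom S T := Hom S T
  id S := ⟨𝟙 _, 𝟙 _, 𝟙 _, .of_horiz_isIso ⟨by simp⟩, .of_horiz_isIso ⟨by simp⟩⟩
  comp f g := ⟨f.b ≫ g.b, f.a ≫ g.a, f.x ≫ g.x, f.isPullback_q.paste_horiz g.isPullback_q,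
    f.isPullback_p.paste_horiz g.isPullback_p⟩
  id_comp f := by apply Hom.ext <;> simp
  comp_id f := by apply Hom.ext <;> simp
  assoc f g h := by apply Hom.ext <;> simp

variable (C)

/-- `(q, p) ↦ q`. -/
def ev01 : CartPair C ⥤ CartArrow C where
  obj S := .of S.q
  map f := CartArrow.homOf (Hom.isPullback_q f)

/-- `(q, p) ↦ p`. -/
def ev12 : CartPair C ⥤ CartArrow C where
  obj S := .of S.p
  map f := CartArrow.homOf (Hom.isPullback_p f)

/-- `(q : B ⟶ A, p : A ⟶ X) ↦ X`. -/
def cod : CartPair C ⥤ C := ev12 C ⋙ CartArrow.cod C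

end CartPair

/-- Composable triples `D ⟶ B ⟶ A ⟶ X`, and natural transformations all of whose squares are
pullbacks between them. -/
structure CartTriple where
  {D B A X : C}
  r : D ⟶ B
  q : B ⟶ A
  p : A ⟶ X

namespace CartTriple

variable {C}

@[ext]
structure Hom (S T : CartTriple C) where
  d : S.D ⟶ T.D
  b : S.B ⟶ T.B
  a : S.A ⟶ T.A
  x : S.X ⟶ T.X
  isPullback_r : IsPullback d S.r T.r b
  isPullback_q : IsPullback b S.q T.q a
  isPullback_p : IsPullback a S.p T.p x

instance : Category (CartTriple C) where
  Hom S T := Hom S T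
  id S := ⟨𝟙 _, 𝟙 _, 𝟙 _, 𝟙 _, .of_horiz_isIso ⟨by simp⟩, .of_horiz_isIso ⟨by simp⟩,
    .of_horiz_isIso ⟨by simp⟩⟩
  comp f g := ⟨f.d ≫ g.d, f.b ≫ g.b, f.a ≫ g.a, f.x ≫ g.x,
    f.isPullback_r.paste_horiz g.isPullback_r, f.isPullback_q.paste_horiz g.isPullback_q,
    f.isPullback_p.paste_horiz g.isPullback_p⟩
  id_comp f := by apply Hom.ext <;> simp
  comp_id f := by apply Hom.ext <;> simp
  assoc f g h := by apply Hom.ext <;> simp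

variable (C)

/-- `(r, q, p) ↦ r`. -/
def ev01 : CartTriple C ⥤ CartArrow C where
  obj S := .of S.r
  map f := CartArrow.homOf (Hom.isPullback_r f)

variable {C}

/-- `(r, q, p) ↦ (q, p)` on morphisms. -/
def Hom.pair {S T : CartTriple C} (f : S ⟶ T) :
    CartPair.mk S.q S.p ⟶ CartPair.mk T.q T.p :=
  ⟨f.b, f.a, f.x, f.isPullback_q, f.isPullback_p⟩

/-- `(r, q, p) ↦ (r ≫ q, p)` on morphisms. -/
def Hom.compPair {S T : CartTriple C} (f : S ⟶ T) :
    CartPair.mk (S.r ≫ S.q) S.p ⟶ CartPair.mk (T.r ≫ T.q) T.p :=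
  ⟨f.d, f.a, f.x, f.isPullback_r.paste_vert f.isPullback_q, f.isPullback_p⟩

end CartTriple

/-- Diagrams in `C` of the shape of the free retract: an object `retr` with a section
`ret.i : retr ⟶ center` of `ret.r : center ⟶ retr`. -/
structure RetractDiagram where
  {retr center : C}
  ret : Retract retr center

namespace RetractDiagram

variable {C}

/-- Natural transformations of retract diagrams. -/
@[ext]
structure Hom (S T : RetractDiagram C) where
  retr : S.retr ⟶ T.retr
  center : S.center ⟶ T.center
  w_i : S.ret.i ≫ center = retr ≫ T.ret.i
  w_r : S.ret.r ≫ retr = center ≫ T.ret.r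

instance : Category (RetractDiagram C) where
  Hom S T := Hom S T
  id S := ⟨𝟙 _, 𝟙 _, by simp, by simp⟩
  comp f g := ⟨f.retr ≫ g.retr, f.center ≫ g.center,
    by rw [← Category.assoc, f.w_i, Category.assoc, g.w_i, Category.assoc],
    by rw [← Category.assoc, f.w_r, Category.assoc, g.w_r, Category.assoc]⟩
  id_comp f := by apply Hom.ext <;> simp
  comp_id f := by apply Hom.ext <;> simp
  assoc f g h := by apply Hom.ext <;> simp

/-- The natural transformations whose square on the retractions `center ⟶ retr` is a pullback. -/
def cartSections (C : Type u) [Category.{v} C] : MorphismProperty (RetractDiagram C) :=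
  fun S T f => IsPullback (Hom.center f) S.ret.r T.ret.r (Hom.retr f)

instance : (cartSections C).IsMultiplicative where
  id_mem S := IsPullback.of_horiz_isIso (fst := 𝟙 _) (g := 𝟙 _) ⟨by simp⟩
  comp_mem _ _ hf hg := IsPullback.paste_horiz hf hg

/-- For retract diagrams of arrows of `C`: the natural transformations whose components at the
center and at the retract are both pullback squares. -/
def cartRetracts (C : Type u) [Category.{v} C] : MorphismProperty (RetractDiagram (Arrow C)) :=
  fun _ _ f => pullbackSquares C (Hom.center f) ∧ pullbackSquares C (Hom.retr f)

instance : (cartRetracts C).IsMultiplicative where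
  id_mem _ := ⟨(pullbackSquares C).id_mem _, (pullbackSquares C).id_mem _⟩
  comp_mem _ _ hf hg :=
    ⟨(pullbackSquares C).comp_mem _ _ hf.1 hg.1, (pullbackSquares C).comp_mem _ _ hf.2 hg.2⟩

end RetractDiagram

/-- Arrows with a specified section, and pullback squares compatible with the sections. -/
abbrev CartSection := WideSubcategory (RetractDiagram.cartSections C)

/-- Forget the section. -/
def CartSection.arrow : CartSection C ⥤ CartArrow C where
  obj S := .of S.obj.ret.r
  map f := CartArrow.homOf f.property

/-- Retract diagrams of arrows, and natural transformations that are pullback squares at the center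
and at the retract. -/
abbrev CartRetract := WideSubcategory (RetractDiagram.cartRetracts C)

/-- Evaluation at the center arrow. -/
def CartRetract.evCenter : CartRetract C ⥤ CartArrow C where
  obj S := ⟨S.obj.center⟩
  map f := ⟨f.hom.center, f.property.1⟩

/-- Evaluation at the retract arrow. -/
def CartRetract.evRetract : CartRetract C ⥤ CartArrow C where
  obj S := ⟨S.obj.retr⟩
  map f := ⟨f.hom.retr, f.property.2⟩

end Diagrams

/-! ### Pushforward -/

section Pushforward

/-- Chosen right adjoints `p_*` of all pullback functors `p^*`. Together with `HasTerminal C`, this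
says that `C` is locally cartesian closed. -/
abbrev ChosenPushforwards (C : Type u) [Category.{v} C] [ChosenPullbacks C] :=
  ∀ {A X : C} (p : A ⟶ X), ExponentiableMorphism p

variable {C : Type u} [Category.{v} C] [ChosenPullbacks C]

open ChosenPullbacksAlong ExponentiableMorphism

lemma pullback_map_left {A X : C} (p : A ⟶ X) {Y Z : Over X} (f : Y ⟶ Z) :
    ((ChosenPullbacksAlong.pullback p).map f).left =
      lift (f := Z.hom) (g := p) (fst Y.hom p ≫ f.left) (snd Y.hom p)
        (by rw [Category.assoc, Over.w f]; exact condition) := by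
  apply ChosenPullbacksAlong.hom_ext
  · rw [lift_fst _ _ _]
    exact congrArg Over.Hom.left ((mapPullbackAdj p).counit.naturality f)
  · rw [lift_snd _ _ _]
    exact Over.w ((ChosenPullbacksAlong.pullback p).map f)

variable [ChosenPushforwards C]

/-- `p_* q`, as an object over `X`. -/
abbrev push {B A X : C} (q : B ⟶ A) (p : A ⟶ X) : Over X := (pushforward p).obj (Over.mk q)

/-- The evaluation `p^* p_* B ⟶ B`: the counit of `p^* ⊣ p_*`. -/
def pushEv {B A X : C} (q : B ⟶ A) (p : A ⟶ X) : pullbackObj (push q p).hom p ⟶ B :=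
  ((pullbackPushforwardAdj p).counit.app (Over.mk q)).left

lemma pushEv_comp {B A X : C} (q : B ⟶ A) (p : A ⟶ X) :
    pushEv q p ≫ q = snd (push q p).hom p :=
  Over.w ((pullbackPushforwardAdj p).counit.app (Over.mk q))

/-- Evaluating a map `m : W ⟶ p_* B` over `X`: given a pullback `V` of `W` along `p`, the
corresponding map `V ⟶ B` over `A`. -/
def pushEval {B A X : C} (q : B ⟶ A) (p : A ⟶ X) {W V : C} (m : W ⟶ (push q p).left)
    (v₁ : V ⟶ W) (v₂ : V ⟶ A) (h : v₁ ≫ m ≫ (push q p).hom = v₂ ≫ p) : V ⟶ B :=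
  lift (f := (push q p).hom) (g := p) (v₁ ≫ m) v₂ (by simpa using h) ≫ pushEv q p

lemma pushEval_comp_q {B A X : C} (q : B ⟶ A) (p : A ⟶ X) {W V : C} (m : W ⟶ (push q p).left)
    (v₁ : V ⟶ W) (v₂ : V ⟶ A) (h : v₁ ≫ m ≫ (push q p).hom = v₂ ≫ p) :
    pushEval q p m v₁ v₂ h ≫ q = v₂ := by
  rw [pushEval, Category.assoc, pushEv_comp, lift_snd _ _ _]

lemma pushEval_precomp {B A X : C} (q : B ⟶ A) (p : A ⟶ X) {W V V' : C}
    (m : W ⟶ (push q p).left) (v₁ : V ⟶ W) (v₂ : V ⟶ A)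
    (h : v₁ ≫ m ≫ (push q p).hom = v₂ ≫ p) (t : V' ⟶ V) :
    t ≫ pushEval q p m v₁ v₂ h =
      pushEval q p m (t ≫ v₁) (t ≫ v₂) (by rw [Category.assoc, h, Category.assoc]) := by
  rw [pushEval, pushEval, ← Category.assoc]
  congr 1
  apply ChosenPullbacksAlong.hom_ext <;> simp

lemma pushEval_congr {B A X : C} (q : B ⟶ A) (p : A ⟶ X) {W W' V : C}
    (m : W ⟶ (push q p).left) (m' : W' ⟶ (push q p).left) (v₁ : V ⟶ W) (v₁' : V ⟶ W')
    (v₂ v₂' : V ⟶ A)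
    (h : v₁ ≫ m ≫ (push q p).hom = v₂ ≫ p) (h' : v₁' ≫ m' ≫ (push q p).hom = v₂' ≫ p)
    (e : v₁ ≫ m = v₁' ≫ m') (e₂ : v₂ = v₂') :
    pushEval q p m v₁ v₂ h = pushEval q p m' v₁' v₂' h' := by
  subst e₂
  simp only [pushEval, e]

lemma push_exists {B A X : C} (q : B ⟶ A) (p : A ⟶ X) {W V : C} {w : W ⟶ X} {v₁ : V ⟶ W}
    {v₂ : V ⟶ A} (h : IsPullback v₁ v₂ w p) (b : V ⟶ B) (hb : b ≫ q = v₂) :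
    ∃ (m : W ⟶ (push q p).left) (hm : m ≫ (push q p).hom = w),
      pushEval q p m v₁ v₂ (by rw [hm, h.w]) = b := by
  let e : pullbackObj w p ⟶ V := h.lift (fst w p) (snd w p) condition
  let β : (ChosenPullbacksAlong.pullback p).obj (Over.mk w) ⟶ Over.mk q :=
    Over.homMk (e ≫ b) (by
      dsimp only [Over.mk_hom]
      rw [Category.assoc, hb]
      exact h.lift_snd _ _ _)
  let m : Over.mk w ⟶ push q p := pushforwardCurry β
  have hβ : (ChosenPullbacksAlong.pullback p).map m ≫ (pullbackPushforwardAdj p).counit.app (Over.mk q) = β := by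
    have := pushforward_uncurry_curry β
    rwa [pushforwardUncurry, Equiv.invFun_as_coe, Adjunction.homEquiv_counit] at this
  refine ⟨m.left, Over.w m, ?_⟩
  have hβ' : pushEval q p m.left (fst w p) (snd w p)
      (by rw [show m.left ≫ (push q p).hom = w from Over.w m]; exact condition) = e ≫ b := by
    have := congrArg Over.Hom.left hβ
    rw [Over.comp_left, pullback_map_left] at this
    exact this
  have hs : lift (f := w) (g := p) v₁ v₂ h.w ≫ e = 𝟙 V := by
    apply h.hom_ext
    · rw [Category.assoc, h.lift_fst, lift_fst _ _ _, Category.id_comp]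
    · rw [Category.assoc, h.lift_snd, lift_snd _ _ _, Category.id_comp]
  rw [← Category.id_comp b, ← hs, Category.assoc, ← hβ', pushEval_precomp]
  apply pushEval_congr
  · rw [lift_fst _ _ _]
  · rw [lift_snd _ _ _]

lemma push_hom_ext {B A X : C} (q : B ⟶ A) (p : A ⟶ X) {W V : C} {v₁ : V ⟶ W}
    {v₂ : V ⟶ A} {m m' : W ⟶ (push q p).left}
    (h : IsPullback v₁ v₂ (m ≫ (push q p).hom) p)
    (hm : m' ≫ (push q p).hom = m ≫ (push q p).hom)
    (e : pushEval q p m v₁ v₂ h.w = pushEval q p m' v₁ v₂ (by rw [hm, h.w])) : m = m' := by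
  let M : Over.mk (m ≫ (push q p).hom) ⟶ push q p := Over.homMk m
  let M' : Over.mk (m ≫ (push q p).hom) ⟶ push q p := Over.homMk m' hm
  suffices M = M' from congrArg Over.Hom.left this
  apply ((pullbackPushforwardAdj p).homEquiv _ _).symm.injective
  rw [Adjunction.homEquiv_counit, Adjunction.homEquiv_counit]
  apply Over.OverMorphism.ext
  rw [Over.comp_left, Over.comp_left, pullback_map_left, pullback_map_left]
  let t := h.lift (fst (m ≫ (push q p).hom) p) (snd (m ≫ (push q p).hom) p) condition
  have := congrArg (t ≫ ·) e
  simp only [pushEval_precomp, t, IsPullback.lift_fst, IsPullback.lift_snd] at this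
  exact this

/-- For a morphism of composable pairs `(q', p') ⟶ (q, p)`, the map `p'_* B' ⟶ p_* B` over
`X' ⟶ X` exists and is unique. -/
lemma exists_pushMap {S T : CartPair C} (f : S ⟶ T) :
    ∃ (m : (push S.q S.p).left ⟶ (push T.q T.p).left)
      (hm : m ≫ (push T.q T.p).hom = (push S.q S.p).hom ≫ f.x),
      pushEval T.q T.p m (fst (push S.q S.p).hom S.p) (snd (push S.q S.p).hom S.p ≫ f.a)
        (by rw [hm, ← Category.assoc, condition, Category.assoc, Category.assoc,
          f.isPullback_p.w]) = pushEv S.q S.p ≫ f.b :=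
  push_exists T.q T.p ((isPullback (push S.q S.p).hom S.p).flip.paste_horiz f.isPullback_p).flip _
    (by rw [Category.assoc, f.isPullback_q.w, ← Category.assoc, pushEv_comp])

/-- The action of pushforward on a morphism of composable pairs: the map `p'_* B' ⟶ p_* B` over
`X' ⟶ X` whose transpose is `p'^* p'_* B' ⟶ B' ⟶ B`. -/
noncomputable def pushMap {S T : CartPair C} (f : S ⟶ T) :
    (push S.q S.p).left ⟶ (push T.q T.p).left := (exists_pushMap f).choose

lemma pushMap_hom {S T : CartPair C} (f : S ⟶ T) :
    pushMap f ≫ (push T.q T.p).hom = (push S.q S.p).hom ≫ f.x :=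
  (exists_pushMap f).choose_spec.choose

lemma pushMap_w {S T : CartPair C} (f : S ⟶ T) {V : C} {v₁ : V ⟶ (push S.q S.p).left}
    {v₂ : V ⟶ S.A} (h : v₁ ≫ (push S.q S.p).hom = v₂ ≫ S.p) :
    v₁ ≫ pushMap f ≫ (push T.q T.p).hom = (v₂ ≫ f.a) ≫ T.p := by
  rw [pushMap_hom, ← Category.assoc, h, Category.assoc, Category.assoc, f.isPullback_p.w]

lemma pushEval_pushMap {S T : CartPair C} (f : S ⟶ T) {V W : C} (m : W ⟶ (push S.q S.p).left)
    (v₁ : V ⟶ W) (v₂ : V ⟶ S.A) (h : v₁ ≫ m ≫ (push S.q S.p).hom = v₂ ≫ S.p) :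
    pushEval T.q T.p (m ≫ pushMap f) v₁ (v₂ ≫ f.a)
      (by simpa using pushMap_w f (v₁ := v₁ ≫ m) (by simpa using h)) =
      pushEval S.q S.p m v₁ v₂ h ≫ f.b := by
  have key := (exists_pushMap f).choose_spec.choose_spec
  generalize_proofs w
  rw [pushEval.eq_def S.q, Category.assoc, ← key, pushEval_precomp]
  apply pushEval_congr
  · rw [lift_fst _ _ _, Category.assoc]; rfl
  · rw [← Category.assoc, lift_snd _ _ _]

lemma pushMap_unique {S T : CartPair C} (f : S ⟶ T)
    (m : (push S.q S.p).left ⟶ (push T.q T.p).left)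
    (hm : m ≫ (push T.q T.p).hom = (push S.q S.p).hom ≫ f.x)
    (e : pushEval T.q T.p m (fst (push S.q S.p).hom S.p) (snd (push S.q S.p).hom S.p ≫ f.a)
        (by rw [hm, ← Category.assoc, condition, Category.assoc, Category.assoc,
          f.isPullback_p.w]) = pushEv S.q S.p ≫ f.b) : m = pushMap f := by
  apply push_hom_ext T.q T.p (v₁ := fst (push S.q S.p).hom S.p)
    (v₂ := snd (push S.q S.p).hom S.p ≫ f.a)
  · rw [e]; exact (exists_pushMap f).choose_spec.choose_spec.symm
  · rw [hm]
    exact ((isPullback (push S.q S.p).hom S.p).flip.paste_horiz f.isPullback_p).flip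
  · rw [hm, pushMap_hom]

lemma pushEval_id {B A X : C} (q : B ⟶ A) (p : A ⟶ X) :
    pushEval q p (𝟙 _) (fst (push q p).hom p) (snd (push q p).hom p)
      (by rw [Category.id_comp]; exact condition) = pushEv q p := by
  rw [pushEval]
  conv_rhs => rw [← Category.id_comp (pushEv q p)]
  congr 1
  apply ChosenPullbacksAlong.hom_ext
  · rw [lift_fst _ _ _, Category.id_comp, Category.comp_id]
  · rw [lift_snd _ _ _, Category.id_comp]

lemma pushMap_id (S : CartPair C) : pushMap (𝟙 S) = 𝟙 _ := by
  symm
  apply pushMap_unique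
  · refine Eq.trans ?_ ((pushEval_id S.q S.p).trans (Category.comp_id _).symm)
    exact pushEval_congr _ _ _ _ _ _ _ _ _ _ rfl (Category.comp_id _)
  · exact (Category.id_comp _).trans (Category.comp_id _).symm

lemma pushMap_comp {S T U : CartPair C} (f : S ⟶ T) (g : T ⟶ U) :
    pushMap (f ≫ g) = pushMap f ≫ pushMap g := by
  symm
  have h₁ : fst (push S.q S.p).hom S.p ≫ 𝟙 _ ≫ (push S.q S.p).hom =
      snd (push S.q S.p).hom S.p ≫ S.p := by rw [Category.id_comp]; exact condition
  have e₁ := pushEval_pushMap f (𝟙 _) _ _ h₁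
  have e₂ := pushEval_pushMap g (𝟙 _ ≫ pushMap f) _ (snd (push S.q S.p).hom S.p ≫ f.a)
    (by rw [Category.id_comp]; exact pushMap_w f condition)
  apply pushMap_unique
  · rw [e₁, pushEval_id] at e₂
    refine Eq.trans ?_ (e₂.trans (Category.assoc _ _ _))
    apply pushEval_congr
    · rw [Category.id_comp]
    · exact (Category.assoc _ _ _).symm
  · rw [Category.assoc, pushMap_hom, ← Category.assoc, pushMap_hom, Category.assoc]; rfl

/-- The Beck–Chevalley condition: pushforward takes pullback squares to pullback squares. -/
lemma isPullback_pushMap {S T : CartPair C} (f : S ⟶ T) :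
    IsPullback (pushMap f) (push S.q S.p).hom (push T.q T.p).hom f.x := by
  have exu : ∀ {Y : C} (a : Y ⟶ (push T.q T.p).left) (b : Y ⟶ S.X)
      (_ : a ≫ (push T.q T.p).hom = b ≫ f.x),
      ∃! m : Y ⟶ (push S.q S.p).left, m ≫ pushMap f = a ∧ m ≫ (push S.q S.p).hom = b := by
    intro Y a b hab
    have hV := isPullback b S.p
    have hV' := (hV.flip.paste_horiz f.isPullback_p).flip
    have ha : fst b S.p ≫ a ≫ (push T.q T.p).hom = (snd b S.p ≫ f.a) ≫ T.p := by
      rw [hab, hV'.w]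
    let b₀ := pushEval T.q T.p a (fst b S.p) (snd b S.p ≫ f.a) ha
    let b' := f.isPullback_q.lift b₀ (snd b S.p) (pushEval_comp_q _ _ _ _ _ _)
    obtain ⟨m, hm, hev⟩ := push_exists S.q S.p hV b' (f.isPullback_q.lift_snd _ _ _)
    refine ⟨m, ⟨?_, hm⟩, ?_⟩
    · symm
      apply push_hom_ext T.q T.p (v₁ := fst b S.p) (v₂ := snd b S.p ≫ f.a)
      · rw [pushEval_pushMap f m (fst b S.p) (snd b S.p) (by rw [hm, hV.w]), hev]
        exact (f.isPullback_q.lift_fst _ _ _).symm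
      · rw [hab]; exact hV'
      · rw [Category.assoc, pushMap_hom, ← Category.assoc, hm, hab]
    · rintro m' ⟨h₁, h₂⟩
      have w' : fst b S.p ≫ m' ≫ (push S.q S.p).hom = snd b S.p ≫ S.p := by rw [h₂, hV.w]
      have hV'' : IsPullback (fst b S.p) (snd b S.p) (m' ≫ (push S.q S.p).hom) S.p := by
        rw [h₂]; exact hV
      refine push_hom_ext S.q S.p hV'' (by rw [hm, h₂]) (Eq.trans ?_ hev.symm)
      apply f.isPullback_q.hom_ext
      · rw [← pushEval_pushMap f m' _ _ w', f.isPullback_q.lift_fst]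
        exact pushEval_congr _ _ _ _ _ _ _ _ _ _ (by rw [h₁]) rfl
      · rw [pushEval_comp_q, f.isPullback_q.lift_snd]
  refine ⟨⟨pushMap_hom f⟩, ⟨PullbackCone.IsLimit.mk _
    (fun s => (exu s.fst s.snd s.condition).choose)
    (fun s => (exu s.fst s.snd s.condition).choose_spec.1.1)
    (fun s => (exu s.fst s.snd s.condition).choose_spec.1.2)
    (fun s m h₁ h₂ => (exu s.fst s.snd s.condition).choose_spec.2 m ⟨h₁, h₂⟩)⟩⟩

/-- The pushforward functor on composable pairs, `(q, p) ↦ p_* q`. -/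
noncomputable def pushPair : CartPair C ⥤ CartArrow C where
  obj S := .of (push S.q S.p).hom
  map f := CartArrow.homOf (isPullback_pushMap f)
  map_id S := by
    apply WideSubcategory.hom_ext
    exact Arrow.hom_ext _ _ (pushMap_id S) rfl
  map_comp f g := by
    apply WideSubcategory.hom_ext
    exact Arrow.hom_ext _ _ (pushMap_comp f g) rfl

/-- `p_* r : p_* (r ≫ q) ⟶ p_* q`, for an arrow `r : D ⟶ B` over `A`. -/
def pushArrow {D B A X : C} (r : D ⟶ B) (q : B ⟶ A) (p : A ⟶ X) :
    (push (r ≫ q) p).left ⟶ (push q p).left :=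
  ((pushforward p).map (Over.homMk r : Over.mk (r ≫ q) ⟶ Over.mk q)).left

lemma pushArrow_hom {D B A X : C} (r : D ⟶ B) (q : B ⟶ A) (p : A ⟶ X) :
    pushArrow r q p ≫ (push q p).hom = (push (r ≫ q) p).hom :=
  Over.w ((pushforward p).map (Over.homMk r : Over.mk (r ≫ q) ⟶ Over.mk q))

lemma pushEval_pushArrow {D B A X : C} (r : D ⟶ B) (q : B ⟶ A) (p : A ⟶ X) {W V : C}
    (m : W ⟶ (push (r ≫ q) p).left) (v₁ : V ⟶ W) (v₂ : V ⟶ A)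
    (h : v₁ ≫ m ≫ (push (r ≫ q) p).hom = v₂ ≫ p) :
    pushEval q p (m ≫ pushArrow r q p) v₁ v₂
      (by rw [Category.assoc, pushArrow_hom, h]) = pushEval (r ≫ q) p m v₁ v₂ h ≫ r := by
  let R : Over.mk (r ≫ q) ⟶ Over.mk q := Over.homMk r
  have nat := congrArg Over.Hom.left ((pullbackPushforwardAdj p).counit.naturality R)
  have nat' : lift (f := (push q p).hom) (g := p)
      (fst (push (r ≫ q) p).hom p ≫ pushArrow r q p) (snd (push (r ≫ q) p).hom p)
      (by rw [Category.assoc, pushArrow_hom]; exact condition) ≫ pushEv q p =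
      pushEv (r ≫ q) p ≫ r := by
    refine Eq.trans ?_ nat
    exact congrArg (· ≫ pushEv q p) (pullback_map_left p ((pushforward p).map R)).symm
  generalize_proofs w
  rw [pushEval.eq_def (r ≫ q), Category.assoc, ← nat', ← Category.assoc, pushEval]
  congr 1
  apply ChosenPullbacksAlong.hom_ext
  · rw [Category.assoc, lift_fst _ _ _, lift_fst _ _ _, ← Category.assoc, ← Category.assoc,
      lift_fst _ _ _]
  · rw [Category.assoc, lift_snd _ _ _, lift_snd _ _ _, lift_snd _ _ _]

lemma pushArrow_naturality {D B A X D' B' A' X' : C} {r : D ⟶ B} {q : B ⟶ A} {p : A ⟶ X}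
    {r' : D' ⟶ B'} {q' : B' ⟶ A'} {p' : A' ⟶ X'}
    (f : CartPair.mk (r' ≫ q') p' ⟶ CartPair.mk (r ≫ q) p)
    (g : CartPair.mk q' p' ⟶ CartPair.mk q p)
    (hb : f.b ≫ r = r' ≫ g.b) (ha : f.a = g.a) (hx : f.x = g.x) :
    pushMap f ≫ pushArrow r q p = pushArrow r' q' p' ≫ pushMap g := by
  let P := push (r' ≫ q') p'
  have w : fst P.hom p' ≫ 𝟙 _ ≫ P.hom = snd P.hom p' ≫ p' := by
    rw [Category.id_comp]; exact condition
  have h₁ := pushEval_pushMap f (𝟙 _) _ _ w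
  have h₂ := pushEval_pushArrow r q p (𝟙 _ ≫ pushMap f)
    (fst P.hom p') (snd P.hom p' ≫ f.a)
    (by rw [Category.id_comp]; exact pushMap_w f condition)
  have h₃ := pushEval_pushArrow r' q' p' (𝟙 _) _ _ w
  have h₄ := pushEval_pushMap g (𝟙 _ ≫ pushArrow r' q' p')
    (fst P.hom p') (snd P.hom p') (by rw [Category.assoc, pushArrow_hom]; exact w)
  have e₁ : (pushMap f ≫ pushArrow r q p) ≫ (push q p).hom = P.hom ≫ f.x := by
    rw [Category.assoc, pushArrow_hom, pushMap_hom]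
  have e₂ : (pushArrow r' q' p' ≫ pushMap g) ≫ (push q p).hom = P.hom ≫ f.x := by
    rw [Category.assoc, pushMap_hom, ← Category.assoc, pushArrow_hom, hx]
  apply push_hom_ext q p (v₁ := fst P.hom p') (v₂ := snd P.hom p' ≫ f.a)
  · have h₅ := h₂.trans (congrArg (· ≫ r) h₁)
    have h₆ := h₄.trans (congrArg (· ≫ g.b) h₃)
    simp only [Category.assoc, hb] at h₅ h₆
    refine Eq.trans ?_ ((h₅.trans h₆.symm).trans ?_)
    · exact pushEval_congr _ _ _ _ _ _ _ _ _ _ (by simp) rfl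
    · exact pushEval_congr _ _ _ _ _ _ _ _ _ _ (by simp) (by rw [ha])
  · rw [e₁]; exact ((isPullback P.hom p').flip.paste_horiz f.isPullback_p).flip
  · rw [e₁, e₂]

/-- The pushforward functor on composable triples, `(r, q, p) ↦ (p_* r, p_* q)`. -/
noncomputable def pushTriple : CartTriple C ⥤ CartPair C where
  obj S := ⟨pushArrow S.r S.q S.p, (push S.q S.p).hom⟩
  map {S T} f :=
    { b := pushMap (CartTriple.Hom.compPair f)
      a := pushMap (CartTriple.Hom.pair f)
      x := f.x
      isPullback_q := by
        refine IsPullback.of_bot ?_ (pushArrow_naturality (CartTriple.Hom.compPair f)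
          (CartTriple.Hom.pair f) f.isPullback_r.w rfl rfl)
          (isPullback_pushMap (CartTriple.Hom.pair f))
        have := isPullback_pushMap (CartTriple.Hom.compPair f)
        rw [← pushArrow_hom, ← pushArrow_hom] at this
        exact this
      isPullback_p := isPullback_pushMap (CartTriple.Hom.pair f) }
  map_id S := by
    apply CartPair.Hom.ext
    · exact pushMap_id (CartPair.mk (S.r ≫ S.q) S.p)
    · exact pushMap_id (CartPair.mk S.q S.p)
    · rfl
  map_comp f g := by
    apply CartPair.Hom.ext
    · exact pushMap_comp (CartTriple.Hom.compPair f) (CartTriple.Hom.compPair g)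
    · exact pushMap_comp (CartTriple.Hom.pair f) (CartTriple.Hom.pair g)
    · rfl

end Pushforward

/-! ### The interval and the functor `δ ⇒ (-)` -/

section Interval

open ChosenPullbacksAlong ExponentiableMorphism

variable {C : Type u} [Category.{v} C] [HasTerminal C] [ChosenPullbacks C]

/-- The identification of `C` with the slice over the terminal object. -/
noncomputable abbrev toSlice : C ⥤ Over (⊤_ C) :=
  (Over.equivalenceOfIsTerminal (terminalIsTerminal (C := C))).inverse

variable (I : C)

/-- `!^* : C ⥤ C / I`, the pullback along `! : I ⟶ ⊤_ C`. -/
noncomputable abbrev bangPullback : C ⥤ Over I :=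
  toSlice ⋙ ChosenPullbacksAlong.pullback (terminal.from I)

/-- `(-) × I`, the composite `!_! !^*`. -/
noncomputable def timesI : C ⥤ C := bangPullback I ⋙ Over.forget I

/-- The projection `X × I ⟶ X`: the counit of `!_! ⊣ !^*`. -/
noncomputable def timesIFst : timesI I ⟶ 𝟭 C where
  app X := ((mapPullbackAdj (terminal.from I)).counit.app (toSlice.obj X)).left
  naturality _ _ f :=
    congrArg Over.Hom.left ((mapPullbackAdj (terminal.from I)).counit.naturality (toSlice.map f))

lemma bangPullback_preserves : PreservesLimitsOfShape WalkingCospan (bangPullback I) := by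
  have : PreservesLimitsOfShape WalkingCospan
      (ChosenPullbacksAlong.pullback (terminal.from I)) :=
    (mapPullbackAdj (terminal.from I)).rightAdjoint_preservesLimits.preservesLimitsOfShape
  infer_instance

instance timesI_preserves : PreservesLimitsOfShape WalkingCospan (timesI I) := by
  have := bangPullback_preserves I
  have : PreservesLimitsOfShape WalkingCospan (Over.forget I) := inferInstance
  unfold timesI
  infer_instance

variable [ChosenPushforwards C]

/-- `(-)^I`, the composite `!_* !^*`. -/
noncomputable def pathObj : C ⥤ C :=
  bangPullback I ⋙ pushforward (terminal.from I) ⋙ Over.forget (⊤_ C)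

/-- `(-)^I × I`. -/
noncomputable abbrev pathTimes : C ⥤ C := pathObj I ⋙ timesI I

/-- The identification of `X^I`, as an object of `C / ⊤_ C`, with `!_* !^* X`. -/
noncomputable def toSlicePathObj (X : C) : toSlice.obj ((pathObj I).obj X) ⟶
    (pushforward (terminal.from I)).obj ((bangPullback I).obj X) :=
  Over.homMk (𝟙 _) (terminal.hom_ext _ _)

lemma toSlicePathObj_naturality {X Y : C} (f : X ⟶ Y) :
    toSlice.map ((pathObj I).map f) ≫ toSlicePathObj I Y =
      toSlicePathObj I X ≫ (pushforward (terminal.from I)).map ((bangPullback I).map f) := by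
  apply Over.OverMorphism.ext
  exact (Category.comp_id _).trans (Category.id_comp _).symm

/-- The counit of `!^* ⊣ !_*`, as a map `X^I × I ⟶ X × I` over `I`. -/
noncomputable def evalOver (X : C) :
    (bangPullback I).obj ((pathObj I).obj X) ⟶ (bangPullback I).obj X :=
  (ChosenPullbacksAlong.pullback (terminal.from I)).map (toSlicePathObj I X) ≫
    (pullbackPushforwardAdj (terminal.from I)).counit.app ((bangPullback I).obj X)

lemma evalOver_naturality {X Y : C} (f : X ⟶ Y) :
    (bangPullback I).map ((pathObj I).map f) ≫ evalOver I Y =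
      evalOver I X ≫ (bangPullback I).map f := by
  have h₁ := congrArg (ChosenPullbacksAlong.pullback (terminal.from I)).map
    (toSlicePathObj_naturality I f)
  rw [Functor.map_comp, Functor.map_comp] at h₁
  have h₂ := (pullbackPushforwardAdj (terminal.from I)).counit.naturality ((bangPullback I).map f)
  unfold evalOver
  rw [Category.assoc]
  refine Eq.trans ?_ (congrArg
    ((ChosenPullbacksAlong.pullback (terminal.from I)).map (toSlicePathObj I X) ≫ ·) h₂)
  refine (Category.assoc _ _ _).symm.trans ?_
  refine (congrArg (· ≫ (pullbackPushforwardAdj (terminal.from I)).counit.app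
    ((bangPullback I).obj Y)) h₁).trans (Category.assoc _ _ _)

/-- The evaluation `ε : X^I × I ⟶ X`: the counit of `!^* ⊣ !_*`, followed by the counit of
`!_! ⊣ !^*`. -/
noncomputable def evalI : pathTimes I ⟶ 𝟭 C where
  app X := (Over.forget I).map (evalOver I X) ≫ (timesIFst I).app X
  naturality X Y f := by
    have h₁ := congrArg (Over.forget I).map (evalOver_naturality I f)
    rw [Functor.map_comp, Functor.map_comp] at h₁
    have h₂ := (timesIFst I).naturality f
    refine (Category.assoc _ _ _).symm.trans ?_
    refine (congrArg (· ≫ (timesIFst I).app Y) h₁).trans ?_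
    refine (Category.assoc _ _ _).trans ?_
    refine (congrArg ((Over.forget I).map (evalOver I X) ≫ ·) h₂).trans ?_
    exact (Category.assoc _ _ _).symm

/-- The map `δ ⇒ p : A^I × I ⟶ A_ε` into the pullback `A_ε` of `p` along `ε`. -/
noncomputable def leibniz {A X : C} (p : A ⟶ X) :
    (pathTimes I).obj A ⟶ pullbackObj p ((evalI I).app X) :=
  lift ((evalI I).app A) ((pathTimes I).map p) ((evalI I).naturality p).symm

instance pathObj_preserves : PreservesLimitsOfShape WalkingCospan (pathObj I) := by
  have := bangPullback_preserves I
  have : PreservesLimitsOfShape WalkingCospan (pushforward (terminal.from I)) :=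
    (pullbackPushforwardAdj (terminal.from I)).rightAdjoint_preservesLimits.preservesLimitsOfShape
  have : PreservesLimitsOfShape WalkingCospan (Over.forget (⊤_ C)) := inferInstance
  unfold pathObj
  infer_instance

/-- The map `A'_ε ⟶ A_ε` induced by a commutative square. -/
noncomputable def leibnizBase {A X A' X' : C} {p' : A' ⟶ X'} {p : A ⟶ X} {a : A' ⟶ A} {x : X' ⟶ X}
    (h : a ≫ p = p' ≫ x) :
    pullbackObj p' ((evalI I).app X') ⟶ pullbackObj p ((evalI I).app X) :=
  pullbackMap _ _ _ _ a ((pathTimes I).map x) x h.symm ((evalI I).naturality x).symm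

lemma leibnizBase_fst {A X A' X' : C} {p' : A' ⟶ X'} {p : A ⟶ X} {a : A' ⟶ A} {x : X' ⟶ X}
    (h : a ≫ p = p' ≫ x) :
    leibnizBase I h ≫ fst p ((evalI I).app X) = fst p' ((evalI I).app X') ≫ a :=
  pullbackMap_fst h.symm ((evalI I).naturality x).symm

lemma leibnizBase_snd {A X A' X' : C} {p' : A' ⟶ X'} {p : A ⟶ X} {a : A' ⟶ A} {x : X' ⟶ X}
    (h : a ≫ p = p' ≫ x) :
    leibnizBase I h ≫ snd p ((evalI I).app X) =
      snd p' ((evalI I).app X') ≫ (pathTimes I).map x :=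
  pullbackMap_snd h.symm ((evalI I).naturality x).symm

lemma leibnizBase_id {A X : C} (p : A ⟶ X) (h : 𝟙 A ≫ p = p ≫ 𝟙 X) :
    leibnizBase I h = 𝟙 _ := by
  apply ChosenPullbacksAlong.hom_ext
  · rw [leibnizBase_fst, Category.comp_id, Category.id_comp]
  · rw [leibnizBase_snd, CategoryTheory.Functor.map_id, Category.comp_id, Category.id_comp]

lemma leibnizBase_comp {A X A' X' A'' X'' : C} {p'' : A'' ⟶ X''} {p' : A' ⟶ X'} {p : A ⟶ X}
    {a' : A'' ⟶ A'} {x' : X'' ⟶ X'} {a : A' ⟶ A} {x : X' ⟶ X}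
    (h' : a' ≫ p' = p'' ≫ x') (h : a ≫ p = p' ≫ x) (h'' : (a' ≫ a) ≫ p = p'' ≫ x' ≫ x) :
    leibnizBase I h'' = leibnizBase I h' ≫ leibnizBase I h := by
  apply ChosenPullbacksAlong.hom_ext
  · rw [leibnizBase_fst, Category.assoc, leibnizBase_fst, ← Category.assoc, ← Category.assoc,
      leibnizBase_fst]
  · rw [leibnizBase_snd, Category.assoc, leibnizBase_snd, Functor.map_comp, ← Category.assoc,
      ← Category.assoc, leibnizBase_snd]

lemma isPullback_leibnizBase {A X A' X' : C} {p' : A' ⟶ X'} {p : A ⟶ X} {a : A' ⟶ A}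
    {x : X' ⟶ X} (h : IsPullback a p' p x) :
    IsPullback (leibnizBase I h.w) (snd p' ((evalI I).app X')) (snd p ((evalI I).app X))
      ((pathTimes I).map x) := by
  refine IsPullback.of_right (h₁₂ := fst p ((evalI I).app X)) (h₂₂ := (evalI I).app X) (v₁₃ := p)
    ?_ (leibnizBase_snd I h.w) (isPullback p ((evalI I).app X))
  rw [leibnizBase_fst]
  have e : (pathTimes I).map x ≫ (evalI I).app X = (evalI I).app X' ≫ x := (evalI I).naturality x
  rw [e]
  exact (isPullback p' ((evalI I).app X')).paste_horiz h

/-- `δ ⇒ (-)` takes pullback squares to pullback squares. -/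
lemma isPullback_leibniz {A X A' X' : C} {p' : A' ⟶ X'} {p : A ⟶ X} {a : A' ⟶ A}
    {x : X' ⟶ X} (h : IsPullback a p' p x) :
    IsPullback ((pathTimes I).map a) (leibniz I p') (leibniz I p) (leibnizBase I h.w) := by
  refine IsPullback.of_bot (v₂₁ := snd p' ((evalI I).app X')) (v₂₂ := snd p ((evalI I).app X))
    (h₃₁ := (pathTimes I).map x) ?_ ?_ (isPullback_leibnizBase I h)
  · rw [leibniz, leibniz, lift_snd _ _ _, lift_snd _ _ _]
    exact h.map (pathTimes I)
  · apply ChosenPullbacksAlong.hom_ext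
    · rw [Category.assoc, Category.assoc,
        leibnizBase_fst, leibniz, leibniz, lift_fst _ _ _, ← Category.assoc, lift_fst _ _ _]
      exact (evalI I).naturality a
    · rw [Category.assoc, Category.assoc,
        leibnizBase_snd, leibniz, leibniz, lift_snd _ _ _, ← Category.assoc, lift_snd _ _ _,
        ← Functor.map_comp, ← Functor.map_comp, h.w]

/-- The functor `δ ⇒ (-)` on arrows and pullback squares. -/
noncomputable def leibnizFunctor : CartArrow C ⥤ CartArrow C where
  obj p := .of (leibniz I p.obj.hom)
  map f := CartArrow.homOf (isPullback_leibniz I f.property)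
  map_id p := by
    apply WideSubcategory.hom_ext
    exact Arrow.hom_ext _ _ ((pathTimes I).map_id _) (leibnizBase_id I p.obj.hom (by simp))
  map_comp f g := by
    apply WideSubcategory.hom_ext
    exact Arrow.hom_ext _ _ ((pathTimes I).map_comp _ _)
      (leibnizBase_comp I f.property.w g.property.w (f ≫ g).property.w)

end Interval

/-! ### Structured trivial fibrations and structured fibrations -/

section Structured

variable {C : Type u} [Category.{v} C] {TFib : Type u₁} [Category.{v₁} TFib]

/-- A commutative square that is cartesian for the codomain functor is a pullback square. -/
lemma pullbackSquares_of_cartesian {f g : Arrow C} (φ : f ⟶ g)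
    (h : cartesianArrows (Arrow.rightFunc : Arrow C ⥤ C) φ) : pullbackSquares C φ := by
  have hφ : (Arrow.rightFunc : Arrow C ⥤ C).IsStronglyCartesian (Arrow.rightFunc.map φ) φ := h
  have exu : ∀ {Y : C} (a : Y ⟶ g.left) (b : Y ⟶ f.right) (_ : a ≫ g.hom = b ≫ φ.right),
      ∃! m : Y ⟶ f.left, m ≫ φ.left = a ∧ m ≫ f.hom = b := by
    intro Y a b hab
    let ψ : Arrow.mk b ⟶ g := Arrow.homMk a φ.right hab
    have hψ : (Arrow.rightFunc : Arrow C ⥤ C).IsHomLift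
        (𝟙 f.right ≫ (Arrow.rightFunc : Arrow C ⥤ C).map φ) ψ := by
      rw [show 𝟙 f.right ≫ (Arrow.rightFunc : Arrow C ⥤ C).map φ =
        (Arrow.rightFunc : Arrow C ⥤ C).map ψ from Category.id_comp _]
      exact Functor.IsHomLift.map ψ
    obtain ⟨χ, ⟨h₁, h₂⟩, h₃⟩ :=
      @hφ.universal_property' (Arrow.mk b) (𝟙 f.right) ψ hψ
    have hχ : 𝟙 f.right = χ.right :=
      IsHomLift.eq_of_isHomLift (a := Arrow.mk b) (b := f)
        (Arrow.rightFunc : Arrow C ⥤ C) (𝟙 f.right) χ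
    refine ⟨χ.left, ⟨congrArg Arrow.Hom.left h₂, ?_⟩, ?_⟩
    · have := Arrow.w χ
      rw [← hχ] at this
      exact this.trans (Category.comp_id _)
    · rintro m ⟨e₁, e₂⟩
      let χ' : Arrow.mk b ⟶ f := Arrow.homMk m (𝟙 f.right) (e₂.trans (Category.comp_id _).symm)
      have hχ' : χ' = χ := by
        refine h₃ χ' ⟨?_, Arrow.hom_ext _ _ e₁ (Category.id_comp _)⟩
        exact (inferInstance : (Arrow.rightFunc : Arrow C ⥤ C).IsHomLift
          ((Arrow.rightFunc : Arrow C ⥤ C).map χ') χ')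
      exact congrArg Arrow.Hom.left hχ'
  exact ⟨⟨Arrow.w φ⟩, ⟨PullbackCone.IsLimit.mk _
    (fun s => (exu s.fst s.snd s.condition).choose)
    (fun s => (exu s.fst s.snd s.condition).choose_spec.1.1)
    (fun s => (exu s.fst s.snd s.condition).choose_spec.1.2)
    (fun s m h₁ h₂ => (exu s.fst s.snd s.condition).choose_spec.2 m ⟨h₁, h₂⟩)⟩⟩

section Restriction

variable {u : TFib ⥤ Arrow C} (hu : IsCartesianFunctor (u ⋙ Arrow.rightFunc) Arrow.rightFunc u)

/-- The restriction of a cartesian functor `u : TFib ⥤ Arrow C` to the wide subcategories of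
cartesian arrows. -/
def restrictCart : Cart (u ⋙ Arrow.rightFunc) ⥤ CartArrow C where
  obj t := ⟨u.obj t.obj⟩
  map f := ⟨u.map f.hom, pullbackSquares_of_cartesian _ (hu.map_cartesian f.hom f.property)⟩
  map_id _ := WideSubcategory.hom_ext _ (u.map_id _)
  map_comp _ _ := WideSubcategory.hom_ext _ (u.map_comp _ _)

end Restriction

/-- `u : TFib ⥤ Arrow C` is a fibred notion of structure: `cod ∘ u` is a Grothendieck fibration, `u`
is a cartesian functor, and `u` restricts to a discrete fibration on cartesian arrows. -/
structure IsFibredNotionOfStructure (u : TFib ⥤ Arrow C) : Prop where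
  isFibered : (u ⋙ Arrow.rightFunc).IsFibered
  isCartesianFunctor : IsCartesianFunctor (u ⋙ Arrow.rightFunc) Arrow.rightFunc u
  isDiscreteFibration : IsDiscreteFibration (restrictCart isCartesianFunctor)

variable {u : TFib ⥤ Arrow C} (hu : IsFibredNotionOfStructure u)

/-- The discrete fibration `u : TFib_cart ⥤ E^2_cart` of structured trivial fibrations. -/
abbrev uCart : Cart (u ⋙ Arrow.rightFunc) ⥤ CartArrow C := restrictCart hu.isCartesianFunctor

/-- Structured trivial fibrations have chosen sections that are stable under pullback. -/
def HasStableSections : Prop :=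
  ∃ s : Cart (u ⋙ Arrow.rightFunc) ⥤ CartSection C, s ⋙ CartSection.arrow C = uCart hu

/-- The lift of evaluation at the retract to the category of retract diagrams of arrows whose center
is a structured trivial fibration. -/
def HasRetractLift : Prop :=
  ∃ L : StrictPullback (CartRetract.evCenter C) (uCart hu) ⥤ Cart (u ⋙ Arrow.rightFunc),
    L ⋙ uCart hu = StrictPullback.π₁ _ _ ⋙ CartRetract.evRetract C

variable [ChosenPullbacks C] [ChosenPushforwards C]

/-- The lift of the pushforward functor on composable triples `(r, q, p)` with `r` a structured
trivial fibration to composable pairs whose first arrow is a structured trivial fibration. -/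
def HasPushforwardLift : Prop :=
  ∃ L : StrictPullback (uCart hu) (CartTriple.ev01 C) ⥤
      StrictPullback (uCart hu) (CartPair.ev01 C),
    L ⋙ StrictPullback.π₂ _ _ = StrictPullback.π₂ _ _ ⋙ pushTriple

variable [HasTerminal C] (I : C)

/-- The category `Fib_cart` of structured fibrations: an arrow `p` together with a structured trivial
fibration over `δ ⇒ p`. -/
abbrev FibCart := StrictPullback (leibnizFunctor I) (uCart hu)

/-- The forgetful functor `Fib_cart ⥤ E^2_cart`. -/
noncomputable abbrev uFib : FibCart hu I ⥤ CartArrow C := StrictPullback.π₁ _ _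

/-- The category `Fib_cart ×_E Fib_cart` of composable pairs of structured fibrations. As `E^3_cart`
is the pullback of `E^2_cart` with itself over `cod` and `dom`, this is the pullback along
`E^3_cart ⥤ E^2_cart × E^2_cart`, `(q, p) ↦ (q, p)`, of two copies of `Fib_cart`. -/
abbrev FibPair :=
  StrictPullback ((uFib hu I).prod (uFib hu I)) ((CartPair.ev01 C).prod' (CartPair.ev12 C))

/-- The functor `u × u : Fib_cart ×_E Fib_cart ⥤ E^3_cart`. -/
noncomputable abbrev uFibPair : FibPair hu I ⥤ CartPair C := StrictPullback.π₂ _ _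

end Structured

end StructuredFrobenius

open StructuredFrobenius

/-! Argue with generalized elements. An element of `p_* B` over `x` is a function that takes each
`a` over `x` to an element of `B` over `a`, and an element of `X^I` is a path. Let `q : B ⟶ A` and
`p : A ⟶ X` be structured fibrations. By (TF2), the pushforward of `δ ⇒ q` along `p^I × I` is a
structured trivial fibration. The core of the proof is that `δ ⇒ p_* q` is a retract of this arrow
as soon as `δ ⇒ p` has a section `σ`, which (TF1) provides; (TF3) then transfers the structure.

Over `(x, i)`, with `x` a path in `X`, an element of the pushed codomain takes each path `α` in `A`
over `x` to an element of `B` over `α(i)`, and an element of the pushed domain takes each such `α`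
to a path in `B` over `α`. The inclusions need no structure on `p`. On codomains, `y` over `x(i)`
goes to `α ↦ y(α(i))`; on domains, a path `y` of functions goes to `α ↦ (j ↦ y(j)(α(j)))`. The
retractions need a path in `A` through a given point, and `σ` supplies it: write `σ(a, x, j)` for
the chosen lift of `x` that passes through `a` at time `j`. On codomains, `s` goes to `a ↦ s(σ(a, x,
i))`; on domains, `s` goes to the path whose value at `j` is `a ↦ s(σ(a, x, j))(j)`. Both are
retractions because `σ(a, x, j)` passes through `a` at `j`, and they commute with the two arrows
because evaluation of the path at `j = i` gives the formula on codomains. The equations are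
`inclCod_retrCod`, `inclDom_retrDom`, `leibniz_inclCod` and `retrDom_leibniz`.

The construction must be functorial for cartesian morphisms of pairs. The inclusions are natural
because they are canonical, and the retractions because the sections of (TF1) are compatible with
pullback squares. Thus the retract diagrams form a functor, to which the lift of (TF3) applies
(`exists_pushforward_fib`).

The assertions about fibrations are formal. In a discrete fibration every arrow is cartesian, and in
the categories of pullback squares every arrow is cartesian over the codomain. These facts compose,
so every arrow of `Fib_cart` is cartesian over the base, and a functor into it over the base is
automatically cartesian. -/

namespace StructuredFrobenius

universe v u v₁ v₂ v₃ v₄ u₁ u₂ u₃ u₄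

/-! ### Pushforward in terms of generalized elements -/

section PushElements

open ChosenPullbacksAlong ExponentiableMorphism

variable {C : Type u} [Category.{v} C] [ChosenPullbacks C] [ChosenPushforwards C]

/-- The value in `B` of a generalized element `y` of `p_* B` at a generalized element `a` of `A`
over the same generalized element of `X`. -/
def pushApp {B A X : C} (q : B ⟶ A) (p : A ⟶ X) {V : C} (y : V ⟶ (push q p).left) (a : V ⟶ A)
    (h : y ≫ (push q p).hom = a ≫ p) : V ⟶ B :=
  lift (f := (push q p).hom) (g := p) y a h ≫ pushEv q p

section

variable {B A X : C} (q : B ⟶ A) (p : A ⟶ X)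

lemma pushEval_eq_pushApp {W V : C} (m : W ⟶ (push q p).left)
    (v₁ : V ⟶ W) (v₂ : V ⟶ A) (h : v₁ ≫ m ≫ (push q p).hom = v₂ ≫ p) :
    pushEval q p m v₁ v₂ h = pushApp q p (v₁ ≫ m) v₂ (by rw [Category.assoc, h]) := rfl

lemma pushApp_comp {V : C} (y : V ⟶ (push q p).left) (a : V ⟶ A)
    (h : y ≫ (push q p).hom = a ≫ p) : pushApp q p y a h ≫ q = a := by
  rw [pushApp, Category.assoc, pushEv_comp, lift_snd _ _ _]

lemma comp_pushApp {V V' : C} (t : V' ⟶ V) (y : V ⟶ (push q p).left) (a : V ⟶ A)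
    (h : y ≫ (push q p).hom = a ≫ p) :
    t ≫ pushApp q p y a h = pushApp q p (t ≫ y) (t ≫ a)
      (by rw [Category.assoc, h, Category.assoc]) := by
  rw [pushApp, pushApp, ← Category.assoc]
  congr 1
  apply ChosenPullbacksAlong.hom_ext <;> simp

lemma pushApp_congr {V : C} {y y' : V ⟶ (push q p).left} {a a' : V ⟶ A}
    {h : y ≫ (push q p).hom = a ≫ p} {h' : y' ≫ (push q p).hom = a' ≫ p}
    (hy : y = y') (ha : a = a') : pushApp q p y a h = pushApp q p y' a' h' := by
  subst hy ha
  rfl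

/-- Transposition along `p^* ⊣ p_*` as a λ-abstraction with its β-rule: `b` prescribes the value at
the generic argument `V`, and every other argument factors through `V`. All maps into pushforwards
below are defined in this way, and only the β-rule is used of them. -/
lemma exists_push_lift {W V : C} {w : W ⟶ X} {v₁ : V ⟶ W} {v₂ : V ⟶ A}
    (hV : IsPullback v₁ v₂ w p) (b : V ⟶ B) (hb : b ≫ q = v₂) :
    ∃ m : W ⟶ (push q p).left, m ≫ (push q p).hom = w ∧
      ∀ {V' : C} (t : V' ⟶ W) (a : V' ⟶ A) (h : (t ≫ m) ≫ (push q p).hom = a ≫ p)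
        (h' : t ≫ w = a ≫ p), pushApp q p (t ≫ m) a h = hV.lift t a h' ≫ b := by
  obtain ⟨m, hm, e⟩ := push_exists q p hV b hb
  refine ⟨m, hm, fun t a h h' => ?_⟩
  rw [← e, pushEval_eq_pushApp, comp_pushApp]
  apply pushApp_congr
  · rw [← Category.assoc, hV.lift_fst]
  · rw [hV.lift_snd]

/-- A generalized element of `p_* B` is determined by its values. -/
lemma push_ext {W : C} {m m' : W ⟶ (push q p).left}
    (hm : m ≫ (push q p).hom = m' ≫ (push q p).hom)
    (e : ∀ {V : C} (t : V ⟶ W) (a : V ⟶ A) (h : (t ≫ m) ≫ (push q p).hom = a ≫ p)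
      (h' : (t ≫ m') ≫ (push q p).hom = a ≫ p),
      pushApp q p (t ≫ m) a h = pushApp q p (t ≫ m') a h') : m = m' :=
  -- The generic argument, given by the projections of the chosen pullback, is enough.
  push_hom_ext q p (isPullback (m ≫ (push q p).hom) p) hm.symm (e _ _ _ _)

/-- The counit form of the transpose of `φ`, read as application. It serves to identify `ε`, which
is built from counits, with application in `pathEv_eq_pushApp`. -/
lemma lift_comp_pullback_map_comp_counit {M : Over X} (φ : M ⟶ push q p) {V : C} (m : V ⟶ M.left)
    (a : V ⟶ A) (h : m ≫ M.hom = a ≫ p) :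
    lift (f := M.hom) (g := p) m a h ≫ ((ChosenPullbacksAlong.pullback p).map φ ≫
      (pullbackPushforwardAdj p).counit.app (Over.mk q)).left =
      pushApp q p (m ≫ φ.left) a (by rw [Category.assoc, Over.w φ, h]) := by
  refine (Category.assoc _ _ _).symm.trans (congrArg (· ≫ pushEv q p) ?_)
  refine (congrArg (lift (f := M.hom) (g := p) m a h ≫ ·) (pullback_map_left p φ)).trans ?_
  apply ChosenPullbacksAlong.hom_ext
  · rw [Category.assoc, lift_fst _ _ _, lift_fst _ _ _, ← Category.assoc, lift_fst _ _ _]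
  · rw [Category.assoc, lift_snd _ _ _, lift_snd _ _ _, lift_snd _ _ _]

/-- The map `p_* r` acts on functions by postcomposition with `r`. -/
lemma pushApp_pushArrow {D : C} (r : D ⟶ B) {V : C} (y : V ⟶ (push (r ≫ q) p).left)
    (a : V ⟶ A) (h : (y ≫ pushArrow r q p) ≫ (push q p).hom = a ≫ p)
    (h' : y ≫ (push (r ≫ q) p).hom = a ≫ p) :
    pushApp q p (y ≫ pushArrow r q p) a h = pushApp (r ≫ q) p y a h' ≫ r := by
  have := pushEval_pushArrow r q p y (𝟙 _) a (by rw [Category.id_comp, h'])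
  rw [pushEval_eq_pushApp, pushEval_eq_pushApp] at this
  refine Eq.trans (pushApp_congr q p (Category.id_comp _).symm rfl) (this.trans ?_)
  exact congrArg (· ≫ r) (pushApp_congr (r ≫ q) p (Category.id_comp _) rfl)

end

/-- The map on pushforwards induced by `f` transports a function along `f`: its value at the image
of `a` is the image of its value at `a`. The equation `ha` is a hypothesis so that `a'` may be given
in another form. -/
lemma pushApp_pushMap {S T : CartPair C} (f : S ⟶ T) {V : C} (y : V ⟶ (push S.q S.p).left)
    (a : V ⟶ S.A) {a' : V ⟶ T.A} (ha : a' = a ≫ f.a)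
    (h : (y ≫ pushMap f) ≫ (push T.q T.p).hom = a' ≫ T.p)
    (h' : y ≫ (push S.q S.p).hom = a ≫ S.p) :
    pushApp T.q T.p (y ≫ pushMap f) a' h = pushApp S.q S.p y a h' ≫ f.b := by
  subst ha
  have := pushEval_pushMap f y (𝟙 _) a (by rw [Category.id_comp, h'])
  rw [pushEval_eq_pushApp, pushEval_eq_pushApp] at this
  refine Eq.trans (pushApp_congr _ _ (Category.id_comp _).symm rfl) (this.trans ?_)
  exact congrArg (· ≫ f.b) (pushApp_congr _ _ (Category.id_comp _) rfl)

/-- Over a cartesian morphism of composable pairs, a generalized element of `p_* B` is determined by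
its values at the generalized elements that come from the domain. -/
lemma push_ext_of_hom {S T : CartPair C} (f : S ⟶ T) {W : C} {m m' : W ⟶ (push T.q T.p).left}
    {w : W ⟶ S.X} (hm : m ≫ (push T.q T.p).hom = w ≫ f.x)
    (hm' : m' ≫ (push T.q T.p).hom = w ≫ f.x)
    (e : ∀ {V : C} (t : V ⟶ W) (a : V ⟶ S.A) (_ : t ≫ w = a ≫ S.p)
      (h : (t ≫ m) ≫ (push T.q T.p).hom = (a ≫ f.a) ≫ T.p)
      (h' : (t ≫ m') ≫ (push T.q T.p).hom = (a ≫ f.a) ≫ T.p),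
      pushApp T.q T.p (t ≫ m) (a ≫ f.a) h = pushApp T.q T.p (t ≫ m') (a ≫ f.a) h') :
    m = m' := by
  refine push_ext _ _ (hm.trans hm'.symm) fun t a h h' => ?_
  -- The base point comes from `S.X`, so the pullback square on `p` makes every argument `a` come
  -- from `S.A`.
  have ha : a ≫ T.p = (t ≫ w) ≫ f.x := by
    rw [← h, Category.assoc, Category.assoc, hm]
  have := e t (f.isPullback_p.lift a (t ≫ w) ha) (f.isPullback_p.lift_snd _ _ _).symm
    (by rw [f.isPullback_p.lift_fst, h]) (by rw [f.isPullback_p.lift_fst, h'])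
  refine Eq.trans (pushApp_congr _ _ rfl ?_) (this.trans (pushApp_congr _ _ rfl ?_))
  · rw [f.isPullback_p.lift_fst]
  · rw [f.isPullback_p.lift_fst]

end PushElements

/-! ### Products with the interval and path objects in terms of generalized elements -/

section PathElements

open ChosenPullbacksAlong ExponentiableMorphism

variable {C : Type u} [Category.{v} C] [HasTerminal C] [ChosenPullbacks C] (I : C)

/-- The projection `X × I ⟶ X`. -/
noncomputable def timesIPr (X : C) : (timesI I).obj X ⟶ X := (timesIFst I).app X

/-- The projection `X × I ⟶ I`. -/
noncomputable def timesISnd (X : C) : (timesI I).obj X ⟶ I := ((bangPullback I).obj X).hom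

lemma isPullback_timesI (X : C) :
    IsPullback (timesIPr I X) (timesISnd I X) (terminal.from X) (terminal.from I) :=
  isPullback (terminal.from X) (terminal.from I)

variable {I} in
/-- The map `V ⟶ X × I` with the given components. -/
noncomputable def timesLift {X V : C} (x : V ⟶ X) (i : V ⟶ I) : V ⟶ (timesI I).obj X :=
  lift (f := terminal.from X) (g := terminal.from I) x i (terminal.hom_ext _ _)

@[simp]
lemma timesLift_fst {X V : C} (x : V ⟶ X) (i : V ⟶ I) :
    timesLift x i ≫ timesIPr I X = x := lift_fst _ _ _

@[simp]
lemma timesLift_snd {X V : C} (x : V ⟶ X) (i : V ⟶ I) :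
    timesLift x i ≫ timesISnd I X = i := lift_snd _ _ _

lemma times_ext {X V : C} {m m' : V ⟶ (timesI I).obj X}
    (h₁ : m ≫ timesIPr I X = m' ≫ timesIPr I X)
    (h₂ : m ≫ timesISnd I X = m' ≫ timesISnd I X) : m = m' :=
  (isPullback_timesI I X).hom_ext h₁ h₂

@[simp]
lemma timesI_map_fst {X Y : C} (f : X ⟶ Y) :
    (timesI I).map f ≫ timesIPr I Y = timesIPr I X ≫ f :=
  (timesIFst I).naturality f

@[simp]
lemma timesI_map_snd {X Y : C} (f : X ⟶ Y) :
    (timesI I).map f ≫ timesISnd I Y = timesISnd I X :=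
  Over.w ((bangPullback I).map f)

lemma comp_timesLift {X V V' : C} (t : V' ⟶ V) (x : V ⟶ X) (i : V ⟶ I) :
    t ≫ timesLift x i = timesLift (t ≫ x) (t ≫ i) := by
  apply times_ext <;> simp

lemma timesLift_map {X Y V : C} (x : V ⟶ X) (i : V ⟶ I) (f : X ⟶ Y) :
    timesLift x i ≫ (timesI I).map f = timesLift (x ≫ f) i := by
  apply times_ext
  · rw [Category.assoc, timesI_map_fst, ← Category.assoc, timesLift_fst, timesLift_fst]
  · simp

variable [ChosenPushforwards C]

variable {I} in
/-- The value of a generalized element of `X^I` at a generalized element of `I`. -/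
noncomputable def pathEv {X V : C} (γ : V ⟶ (pathObj I).obj X) (i : V ⟶ I) : V ⟶ X :=
  timesLift γ i ≫ (evalI I).app X

lemma comp_pathEv {X V V' : C} (t : V' ⟶ V) (γ : V ⟶ (pathObj I).obj X) (i : V ⟶ I) :
    t ≫ pathEv γ i = pathEv (t ≫ γ) (t ≫ i) := by
  rw [pathEv, pathEv, ← Category.assoc, comp_timesLift]

lemma pathEv_map {X Y V : C} (γ : V ⟶ (pathObj I).obj X) (i : V ⟶ I) (f : X ⟶ Y) :
    pathEv (γ ≫ (pathObj I).map f) i = pathEv γ i ≫ f := by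
  rw [pathEv, pathEv, Category.assoc, ← timesLift_map, Category.assoc]
  exact congrArg (timesLift γ i ≫ ·) ((evalI I).naturality f)

/-- The projection `X^I × I ⟶ X^I`. -/
noncomputable def pathPr (X : C) : (pathTimes I).obj X ⟶ (pathObj I).obj X := timesIPr I _

/-- The projection `X^I × I ⟶ I`. -/
noncomputable def timePr (X : C) : (pathTimes I).obj X ⟶ I := timesISnd I _

variable {I} in
/-- The map `V ⟶ X^I × I` with the given components. -/
noncomputable def pathPair {X V : C} (γ : V ⟶ (pathObj I).obj X) (i : V ⟶ I) :
    V ⟶ (pathTimes I).obj X := timesLift γ i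

@[simp]
lemma pathPair_pathPr {X V : C} (γ : V ⟶ (pathObj I).obj X) (i : V ⟶ I) :
    pathPair γ i ≫ pathPr I X = γ := timesLift_fst _ _ _

@[simp]
lemma pathPair_timePr {X V : C} (γ : V ⟶ (pathObj I).obj X) (i : V ⟶ I) :
    pathPair γ i ≫ timePr I X = i := timesLift_snd _ _ _

lemma pathTimes_ext {X V : C} {m m' : V ⟶ (pathTimes I).obj X}
    (h₁ : m ≫ pathPr I X = m' ≫ pathPr I X) (h₂ : m ≫ timePr I X = m' ≫ timePr I X) : m = m' :=
  times_ext I h₁ h₂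

lemma pathTimes_map_pathPr {X Y : C} (f : X ⟶ Y) :
    (pathTimes I).map f ≫ pathPr I Y = pathPr I X ≫ (pathObj I).map f := timesI_map_fst _ _

lemma pathTimes_map_timePr {X Y : C} (f : X ⟶ Y) :
    (pathTimes I).map f ≫ timePr I Y = timePr I X := timesI_map_snd _ _

lemma comp_pathPair {X V V' : C} (t : V' ⟶ V) (γ : V ⟶ (pathObj I).obj X) (i : V ⟶ I) :
    t ≫ pathPair γ i = pathPair (t ≫ γ) (t ≫ i) := comp_timesLift _ _ _ _

lemma pathPair_map {X Y V : C} (γ : V ⟶ (pathObj I).obj X) (i : V ⟶ I) (f : X ⟶ Y) :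
    pathPair γ i ≫ (pathTimes I).map f = pathPair (γ ≫ (pathObj I).map f) i := timesLift_map _ _ _ _

lemma pathPair_eta {X V : C} (m : V ⟶ (pathTimes I).obj X) :
    pathPair (m ≫ pathPr I X) (m ≫ timePr I X) = m := by
  apply pathTimes_ext <;> simp

lemma pathPair_evalI {X V : C} (γ : V ⟶ (pathObj I).obj X) (i : V ⟶ I) :
    pathPair γ i ≫ (evalI I).app X = pathEv γ i := rfl

lemma comp_evalI {X V : C} (m : V ⟶ (pathTimes I).obj X) :
    m ≫ (evalI I).app X = pathEv (m ≫ pathPr I X) (m ≫ timePr I X) := by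
  rw [← pathPair_evalI, pathPair_eta]

/-- Since `X^I` is the pushforward of `X × I` along `I ⟶ ⊤_ C`, a path is a function on `I` with
values in `X × I`, and its evaluation is the `X`-component of the value. The two facts below reduce
to those on pushforwards through this formula. -/
lemma pathEv_eq_pushApp {X V : C} (γ : V ⟶ (pathObj I).obj X) (i : V ⟶ I) :
    pathEv γ i = pushApp (timesISnd I X) (terminal.from I) γ i (terminal.hom_ext _ _) ≫
      timesIPr I X := by
  refine (Category.assoc (timesLift γ i) ((Over.forget I).map (evalOver I X)) _).symm.trans ?_
  refine congrArg (· ≫ timesIPr I X) ?_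
  refine (lift_comp_pullback_map_comp_counit (timesISnd I X) (terminal.from I)
    (toSlicePathObj I X) γ i (terminal.hom_ext _ _)).trans ?_
  exact pushApp_congr _ _ (Category.comp_id _) rfl

lemma path_ext {X W : C} {γ γ' : W ⟶ (pathObj I).obj X}
    (e : ∀ {V : C} (t : V ⟶ W) (i : V ⟶ I), pathEv (t ≫ γ) i = pathEv (t ≫ γ') i) : γ = γ' := by
  refine push_ext (timesISnd I X) (terminal.from I) (terminal.hom_ext _ _) fun t i h h' => ?_
  apply times_ext
  · have := e t i
    rwa [pathEv_eq_pushApp, pathEv_eq_pushApp] at this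
  · exact (pushApp_comp _ _ _ _ _).trans (pushApp_comp _ _ _ _ _).symm

/-- Exponential transposition: `g` is completed by the projection to `I` to a map into `X × I` over
`I`, to which `exists_push_lift` applies. -/
lemma exists_path {X W : C} (g : (timesI I).obj W ⟶ X) :
    ∃ γ : W ⟶ (pathObj I).obj X, ∀ {V : C} (t : V ⟶ W) (i : V ⟶ I),
      pathEv (t ≫ γ) i = timesLift t i ≫ g := by
  obtain ⟨m, -, e⟩ := exists_push_lift (timesISnd I X) (terminal.from I) (isPullback_timesI I W)
    (timesLift g (timesISnd I W)) (timesLift_snd _ _ _)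
  refine ⟨m, fun t i => ?_⟩
  have := e t i (terminal.hom_ext _ _) (terminal.hom_ext _ _)
  rw [pathEv_eq_pushApp]
  refine (congrArg (· ≫ timesIPr I X) this).trans ?_
  rw [Category.assoc, timesLift_fst]
  congr 1
  exact times_ext I ((isPullback_timesI I W).lift_fst _ _ _ |>.trans (timesLift_fst I t i).symm)
    ((isPullback_timesI I W).lift_snd _ _ _ |>.trans (timesLift_snd I t i).symm)

end PathElements

/-! ### Sections of `δ ⇒ p` as path lifting, and the two inclusions -/

section Retraction

open ChosenPullbacksAlong ExponentiableMorphism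

variable {C : Type u} [Category.{v} C] [HasTerminal C] [ChosenPullbacks C] [ChosenPushforwards C]
  (I : C)

lemma leibniz_fst {A X : C} (p : A ⟶ X) :
    leibniz I p ≫ fst p ((evalI I).app X) = (evalI I).app A := lift_fst _ _ _

lemma leibniz_snd {A X : C} (p : A ⟶ X) :
    leibniz I p ≫ snd p ((evalI I).app X) = (pathTimes I).map p := lift_snd _ _ _

variable {I}

section Transport

variable {A X : C} {p : A ⟶ X} (σ : pullbackObj p ((evalI I).app X) ⟶ (pathTimes I).obj A)

/-- The value of a map `σ : A_ε ⟶ A^I × I` at a pair of generalized elements. -/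
noncomputable def sectionAt {V : C} (a : V ⟶ A) (x : V ⟶ (pathTimes I).obj X)
    (h : a ≫ p = x ≫ (evalI I).app X) : V ⟶ (pathTimes I).obj A :=
  lift (f := p) (g := (evalI I).app X) a x h ≫ σ

lemma comp_sectionAt {V V' : C} (t : V' ⟶ V) (a : V ⟶ A) (x : V ⟶ (pathTimes I).obj X)
    (h : a ≫ p = x ≫ (evalI I).app X) :
    t ≫ sectionAt σ a x h = sectionAt σ (t ≫ a) (t ≫ x)
      (by rw [Category.assoc, h, Category.assoc]) := by
  rw [sectionAt, sectionAt, ← Category.assoc]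
  congr 1
  apply ChosenPullbacksAlong.hom_ext <;> simp

lemma sectionAt_congr {V : C} {a a' : V ⟶ A} {x x' : V ⟶ (pathTimes I).obj X}
    {h : a ≫ p = x ≫ (evalI I).app X} {h' : a' ≫ p = x' ≫ (evalI I).app X}
    (ha : a = a') (hx : x = x') : sectionAt σ a x h = sectionAt σ a' x' h' := by
  subst ha hx
  rfl

variable {σ}

/-- The section equation has two components. This one says that the lifted path, at its own time,
passes through `a`; `sectionAt_map` says that it lies over `x`, with the same time. -/
lemma sectionAt_evalI (hσ : σ ≫ leibniz I p = 𝟙 _) {V : C} (a : V ⟶ A) (x : V ⟶ (pathTimes I).obj X)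
    (h : a ≫ p = x ≫ (evalI I).app X) : sectionAt σ a x h ≫ (evalI I).app A = a := by
  rw [← leibniz_fst I p, sectionAt, Category.assoc, ← Category.assoc σ, hσ, Category.id_comp]
  exact lift_fst _ _ _

lemma sectionAt_map (hσ : σ ≫ leibniz I p = 𝟙 _) {V : C} (a : V ⟶ A) (x : V ⟶ (pathTimes I).obj X)
    (h : a ≫ p = x ≫ (evalI I).app X) : sectionAt σ a x h ≫ (pathTimes I).map p = x := by
  rw [← leibniz_snd I p, sectionAt, Category.assoc, ← Category.assoc σ, hσ, Category.id_comp]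
  exact lift_snd _ _ _

end Transport

section Maps

variable (I) {B A X : C} (q : B ⟶ A) (p : A ⟶ X)

/-- The codomain of `δ ⇒ q`, pushed forward along `p^I × I`. -/
noncomputable abbrev pushCod : Over ((pathTimes I).obj X) :=
  push (snd q ((evalI I).app A)) ((pathTimes I).map p)

/-- The domain of `δ ⇒ q`, pushed forward along `p^I × I`. -/
noncomputable abbrev pushDom : Over ((pathTimes I).obj X) :=
  push (leibniz I q ≫ snd q ((evalI I).app A)) ((pathTimes I).map p)

/-- Values of generalized elements of `pushCod`. -/
noncomputable abbrev codApp {V : C} (s : V ⟶ (pushCod I q p).left) (α : V ⟶ (pathTimes I).obj A)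
    (h : s ≫ (pushCod I q p).hom = α ≫ (pathTimes I).map p) :
    V ⟶ pullbackObj q ((evalI I).app A) :=
  pushApp (snd q ((evalI I).app A)) ((pathTimes I).map p) s α h

/-- Values of generalized elements of `pushDom`. -/
noncomputable abbrev domApp {V : C} (s : V ⟶ (pushDom I q p).left) (α : V ⟶ (pathTimes I).obj A)
    (h : s ≫ (pushDom I q p).hom = α ≫ (pathTimes I).map p) : V ⟶ (pathTimes I).obj B :=
  pushApp (leibniz I q ≫ snd q ((evalI I).app A)) ((pathTimes I).map p) s α h

lemma domApp_map {V : C} (s : V ⟶ (pushDom I q p).left) (α : V ⟶ (pathTimes I).obj A)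
    (h : s ≫ (pushDom I q p).hom = α ≫ (pathTimes I).map p) :
    domApp I q p s α h ≫ (pathTimes I).map q = α := by
  rw [← leibniz_snd I q]
  exact pushApp_comp _ _ _ _ _

lemma domApp_timePr {V : C} (s : V ⟶ (pushDom I q p).left) (α : V ⟶ (pathTimes I).obj A)
    (h : s ≫ (pushDom I q p).hom = α ≫ (pathTimes I).map p) :
    domApp I q p s α h ≫ timePr I B = α ≫ timePr I A := by
  rw [← pathTimes_map_timePr I q, ← Category.assoc, domApp_map]

lemma domApp_pathPr {V : C} (s : V ⟶ (pushDom I q p).left) (α : V ⟶ (pathTimes I).obj A)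
    (h : s ≫ (pushDom I q p).hom = α ≫ (pathTimes I).map p) :
    domApp I q p s α h ≫ pathPr I B ≫ (pathObj I).map q = α ≫ pathPr I A := by
  rw [← pathTimes_map_pathPr, ← Category.assoc, domApp_map]

/-- If `α` lies over `(x, i)`, then `α(i)` lies over `x(i)` by naturality of `ε`, so that a function
over `x(i)` may be applied to it. -/
lemma inclCod_w {V : C} {t : V ⟶ pullbackObj (push q p).hom ((evalI I).app X)}
    {α : V ⟶ (pathTimes I).obj A}
    (h : t ≫ snd (push q p).hom ((evalI I).app X) = α ≫ (pathTimes I).map p) :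
    (t ≫ fst (push q p).hom ((evalI I).app X)) ≫ (push q p).hom =
      (α ≫ (evalI I).app A) ≫ p := by
  have e : (pathTimes I).map p ≫ (evalI I).app X = (evalI I).app A ≫ p := (evalI I).naturality p
  rw [Category.assoc, Category.assoc, condition, ← Category.assoc, h, ← e]
  exact Category.assoc _ _ _

/-- The map `(y, (x, i)) ↦ (α ↦ (y(α(i)), α))`, for `y` over `x(i)`. -/
lemma exists_inclCod :
    ∃ m : pullbackObj (push q p).hom ((evalI I).app X) ⟶ (pushCod I q p).left,
      m ≫ (pushCod I q p).hom = snd (push q p).hom ((evalI I).app X) ∧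
      ∀ {V : C} (t : V ⟶ pullbackObj (push q p).hom ((evalI I).app X))
        (α : V ⟶ (pathTimes I).obj A)
        (h : (t ≫ m) ≫ (pushCod I q p).hom = α ≫ (pathTimes I).map p)
        (h' : t ≫ snd (push q p).hom ((evalI I).app X) = α ≫ (pathTimes I).map p),
        codApp I q p (t ≫ m) α h =
          lift (f := q) (g := (evalI I).app A)
            (pushApp q p (t ≫ fst (push q p).hom ((evalI I).app X)) (α ≫ (evalI I).app A)
              (inclCod_w I q p h')) α (pushApp_comp _ _ _ _ _) := by
  let w := snd (push q p).hom ((evalI I).app X)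
  have hV := isPullback w ((pathTimes I).map p)
  obtain ⟨m, hm, e⟩ := exists_push_lift (snd q ((evalI I).app A)) ((pathTimes I).map p) hV
    (lift (f := q) (g := (evalI I).app A)
      (pushApp q p (fst w ((pathTimes I).map p) ≫ fst (push q p).hom ((evalI I).app X))
        (snd w ((pathTimes I).map p) ≫ (evalI I).app A) (inclCod_w I q p hV.w))
      (snd w ((pathTimes I).map p)) (pushApp_comp _ _ _ _ _)) (lift_snd _ _ _)
  refine ⟨m, hm, fun t α h h' => (e t α h h').trans ?_⟩
  apply ChosenPullbacksAlong.hom_ext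
  · rw [Category.assoc, lift_fst _ _ _, lift_fst _ _ _, comp_pushApp]
    apply pushApp_congr
    · rw [← Category.assoc, hV.lift_fst]
    · rw [← Category.assoc, hV.lift_snd]
  · rw [Category.assoc, lift_snd _ _ _, lift_snd _ _ _, hV.lift_snd]

/-- The inclusion into the pushforward along `p^I × I` of the codomain of `δ ⇒ q` of the codomain of
`δ ⇒ p_* q`. -/
noncomputable def inclCod : pullbackObj (push q p).hom ((evalI I).app X) ⟶ (pushCod I q p).left :=
  (exists_inclCod I q p).choose

lemma inclCod_hom : inclCod I q p ≫ (pushCod I q p).hom = snd (push q p).hom ((evalI I).app X) :=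
  (exists_inclCod I q p).choose_spec.1

lemma codApp_inclCod {V : C} (t : V ⟶ pullbackObj (push q p).hom ((evalI I).app X))
    (α : V ⟶ (pathTimes I).obj A)
    (h : (t ≫ inclCod I q p) ≫ (pushCod I q p).hom = α ≫ (pathTimes I).map p)
    (h' : t ≫ snd (push q p).hom ((evalI I).app X) = α ≫ (pathTimes I).map p) :
    codApp I q p (t ≫ inclCod I q p) α h =
      lift (f := q) (g := (evalI I).app A)
        (pushApp q p (t ≫ fst (push q p).hom ((evalI I).app X)) (α ≫ (evalI I).app A)
          (inclCod_w I q p h')) α (pushApp_comp _ _ _ _ _) :=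
  (exists_inclCod I q p).choose_spec.2 t α h h'

/-- Pointwise application of a path of functions to a path of arguments, `y ↦ (α ↦ (j ↦
y(j)(α(j))))`. The formula holds at every time `j`, not only at the time component of `t`. -/
lemma exists_inclDom :
    ∃ m : (pathTimes I).obj (push q p).left ⟶ (pushDom I q p).left,
      m ≫ (pushDom I q p).hom = (pathTimes I).map (push q p).hom ∧
      ∀ {V : C} (t : V ⟶ (pathTimes I).obj (push q p).left) (α : V ⟶ (pathTimes I).obj A)
        (h : (t ≫ m) ≫ (pushDom I q p).hom = α ≫ (pathTimes I).map p) (i : V ⟶ I)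
        (h' : pathEv (t ≫ pathPr I _) i ≫ (push q p).hom = pathEv (α ≫ pathPr I _) i ≫ p),
        pathEv (domApp I q p (t ≫ m) α h ≫ pathPr I B) i =
          pushApp q p (pathEv (t ≫ pathPr I _) i) (pathEv (α ≫ pathPr I _) i) h' := by
  -- The functor `(-)^I × I` preserves pullbacks, so a path of functions and a path of arguments
  -- over the same path form a path in `p^* p_* B`; the evaluation map is then applied to this path.
  have hV := (isPullback (push q p).hom p).map (pathTimes I)
  obtain ⟨m, hm, e⟩ := exists_push_lift (leibniz I q ≫ snd q ((evalI I).app A))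
    ((pathTimes I).map p) hV ((pathTimes I).map (pushEv q p))
    (by rw [leibniz_snd, ← Functor.map_comp, pushEv_comp])
  refine ⟨m, hm, fun t α h i h' => ?_⟩
  have h₀ : t ≫ (pathTimes I).map (push q p).hom = α ≫ (pathTimes I).map p := by
    rw [← hm, ← Category.assoc, h]
  rw [domApp, e t α h h₀, Category.assoc, pathTimes_map_pathPr, ← Category.assoc, pathEv_map,
    pushApp]
  congr 1
  apply ChosenPullbacksAlong.hom_ext
  · rw [lift_fst _ _ _, ← pathEv_map, Category.assoc, ← pathTimes_map_pathPr, ← Category.assoc,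
      hV.lift_fst]
  · rw [lift_snd _ _ _, ← pathEv_map, Category.assoc, ← pathTimes_map_pathPr, ← Category.assoc,
      hV.lift_snd]

/-- The inclusion into the pushforward along `p^I × I` of the domain of `δ ⇒ q` of the domain of
`δ ⇒ p_* q`. -/
noncomputable def inclDom : (pathTimes I).obj (push q p).left ⟶ (pushDom I q p).left :=
  (exists_inclDom I q p).choose

lemma inclDom_hom : inclDom I q p ≫ (pushDom I q p).hom = (pathTimes I).map (push q p).hom :=
  (exists_inclDom I q p).choose_spec.1

lemma pathEv_domApp_inclDom {V : C} (t : V ⟶ (pathTimes I).obj (push q p).left)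
    (α : V ⟶ (pathTimes I).obj A)
    (h : (t ≫ inclDom I q p) ≫ (pushDom I q p).hom = α ≫ (pathTimes I).map p) (i : V ⟶ I)
    (h' : pathEv (t ≫ pathPr I _) i ≫ (push q p).hom = pathEv (α ≫ pathPr I _) i ≫ p) :
    pathEv (domApp I q p (t ≫ inclDom I q p) α h ≫ pathPr I B) i =
      pushApp q p (pathEv (t ≫ pathPr I _) i) (pathEv (α ≫ pathPr I _) i) h' :=
  (exists_inclDom I q p).choose_spec.2 t α h i h'

lemma pathEv_w {V Y : C} {f : Y ⟶ X} {t : V ⟶ (pathTimes I).obj Y} {α : V ⟶ (pathTimes I).obj A}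
    (h : t ≫ (pathTimes I).map f = α ≫ (pathTimes I).map p) (i : V ⟶ I) :
    pathEv (t ≫ pathPr I _) i ≫ f = pathEv (α ≫ pathPr I _) i ≫ p := by
  rw [← pathEv_map, ← pathEv_map, Category.assoc, Category.assoc, ← pathTimes_map_pathPr,
    ← pathTimes_map_pathPr, ← Category.assoc, h, Category.assoc]

end Maps

end Retraction

/-! ### The two retractions determined by a section of `δ ⇒ p` -/

section Retraction

open ChosenPullbacksAlong ExponentiableMorphism

variable {C : Type u} [Category.{v} C] [HasTerminal C] [ChosenPullbacks C] [ChosenPushforwards C]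
  {I : C} {B A X : C} (q : B ⟶ A) {p : A ⟶ X}
  {σ : pullbackObj p ((evalI I).app X) ⟶ (pathTimes I).obj A}

/-- The map `s ↦ (a ↦ s(σ(a, x, i)))` over `(x, i)`. The value has first component over `a` because
the lifted path passes through `a` at time `i`. -/
lemma exists_retrCod (hσ : σ ≫ leibniz I p = 𝟙 _) :
    ∃ m : (pushCod I q p).left ⟶ pullbackObj (push q p).hom ((evalI I).app X),
      m ≫ snd (push q p).hom ((evalI I).app X) = (pushCod I q p).hom ∧
      ∀ {V : C} (s : V ⟶ (pushCod I q p).left) (a : V ⟶ A)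
        (h : (s ≫ m ≫ fst (push q p).hom ((evalI I).app X)) ≫ (push q p).hom = a ≫ p)
        (h' : a ≫ p = (s ≫ (pushCod I q p).hom) ≫ (evalI I).app X),
        pushApp q p (s ≫ m ≫ fst (push q p).hom ((evalI I).app X)) a h =
          codApp I q p s (sectionAt σ a (s ≫ (pushCod I q p).hom) h')
            (sectionAt_map hσ _ _ _).symm ≫ fst q ((evalI I).app A) := by
  let w : (pushCod I q p).left ⟶ X := (pushCod I q p).hom ≫ (evalI I).app X
  have hV := isPullback w p
  have h₀ : snd w p ≫ p = (fst w p ≫ (pushCod I q p).hom) ≫ (evalI I).app X :=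
    hV.w.symm.trans (Category.assoc _ _ _).symm
  obtain ⟨m, hm, e⟩ := exists_push_lift q p hV
    (codApp I q p (fst w p) (sectionAt σ (snd w p) (fst w p ≫ (pushCod I q p).hom) h₀)
      (sectionAt_map hσ _ _ _).symm ≫ fst q ((evalI I).app A))
    (by
      rw [Category.assoc, condition, ← Category.assoc, codApp, pushApp_comp]
      exact sectionAt_evalI hσ _ _ _)
  refine ⟨lift (f := (push q p).hom) (g := (evalI I).app X) m (pushCod I q p).hom hm,
    lift_snd _ _ _, fun s a h h' => ?_⟩
  have h₁ : (s ≫ m) ≫ (push q p).hom = a ≫ p := by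
    rw [← h]
    congr 2
    exact (lift_fst _ _ _).symm
  refine (pushApp_congr q p (congrArg (s ≫ ·) (lift_fst _ _ _)) rfl (h' := h₁)).trans ?_
  rw [e s a h₁ (by rw [h']; exact (Category.assoc _ _ _).symm), ← Category.assoc, codApp,
    comp_pushApp]
  congr 1
  apply pushApp_congr
  · rw [hV.lift_fst]
  · rw [comp_sectionAt]
    apply sectionAt_congr
    · rw [hV.lift_snd]
    · rw [← Category.assoc, hV.lift_fst]

/-- The retraction onto the codomain of `δ ⇒ p_* q` determined by a section of `δ ⇒ p`. -/
noncomputable def retrCod (hσ : σ ≫ leibniz I p = 𝟙 _) :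
    (pushCod I q p).left ⟶ pullbackObj (push q p).hom ((evalI I).app X) :=
  (exists_retrCod q hσ).choose

lemma retrCod_snd (hσ : σ ≫ leibniz I p = 𝟙 _) :
    retrCod q hσ ≫ snd (push q p).hom ((evalI I).app X) = (pushCod I q p).hom :=
  (exists_retrCod q hσ).choose_spec.1

lemma pushApp_retrCod (hσ : σ ≫ leibniz I p = 𝟙 _) {V : C} (s : V ⟶ (pushCod I q p).left)
    (a : V ⟶ A)
    (h : (s ≫ retrCod q hσ ≫ fst (push q p).hom ((evalI I).app X)) ≫ (push q p).hom = a ≫ p)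
    (h' : a ≫ p = (s ≫ (pushCod I q p).hom) ≫ (evalI I).app X) :
    pushApp q p (s ≫ retrCod q hσ ≫ fst (push q p).hom ((evalI I).app X)) a h =
      codApp I q p s (sectionAt σ a (s ≫ (pushCod I q p).hom) h')
        (sectionAt_map hσ _ _ _).symm ≫ fst q ((evalI I).app A) :=
  (exists_retrCod q hσ).choose_spec.2 s a _ _

/-- The generalized element `α` of `A^I × I`, with its component in `I` replaced by that of `x`. -/
noncomputable def resetTime {V : C} (α : V ⟶ (pathTimes I).obj A) (x : V ⟶ (pathTimes I).obj X) :
    V ⟶ (pathTimes I).obj A := pathPair (α ≫ pathPr I A) (x ≫ timePr I X)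

lemma comp_resetTime {V V' : C} (t : V' ⟶ V) (α : V ⟶ (pathTimes I).obj A)
    (x : V ⟶ (pathTimes I).obj X) : t ≫ resetTime α x = resetTime (t ≫ α) (t ≫ x) := by
  rw [resetTime, resetTime, comp_pathPair, Category.assoc, Category.assoc]

lemma resetTime_map {V A' : C} (α : V ⟶ (pathTimes I).obj A)
    (x : V ⟶ (pathTimes I).obj X) (f : A ⟶ A') :
    resetTime α x ≫ (pathTimes I).map f = resetTime (α ≫ (pathTimes I).map f) x := by
  rw [resetTime, resetTime, pathPair_map, Category.assoc, Category.assoc, pathTimes_map_pathPr]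

lemma resetTime_pathPr {V : C} (α : V ⟶ (pathTimes I).obj A) (x : V ⟶ (pathTimes I).obj X) :
    resetTime α x ≫ pathPr I A = α ≫ pathPr I A := pathPair_pathPr _ _ _

/-- The lift, given by a section of `δ ⇒ p`, of the path `x` through `a` at `i`, with the component
in `I` of `x`. -/
noncomputable def transport (σ : pullbackObj p ((evalI I).app X) ⟶ (pathTimes I).obj A) {V : C}
    (x : V ⟶ (pathTimes I).obj X) (i : V ⟶ I) (a : V ⟶ A) (h : a ≫ p = pathEv (x ≫ pathPr I X) i) :
    V ⟶ (pathTimes I).obj A :=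
  resetTime (sectionAt σ a (pathPair (x ≫ pathPr I X) i) (by rw [h, pathPair_evalI])) x

/-- The lift through `a` at time `i` lies over the path of `x` paired with `i`, whereas a function
over `x` only accepts arguments over `x` with its own time component. Resetting the time makes the
lift an admissible argument. -/
lemma transport_map (hσ : σ ≫ leibniz I p = 𝟙 _) {V : C}
    (x : V ⟶ (pathTimes I).obj X) (i : V ⟶ I) (a : V ⟶ A) (h : a ≫ p = pathEv (x ≫ pathPr I X) i) :
    x = transport σ x i a h ≫ (pathTimes I).map p := by
  rw [transport, resetTime_map, sectionAt_map hσ, resetTime, pathPair_pathPr, pathPair_eta]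

/-- Resetting the time leaves the path unchanged, so the lift still passes through `a` at `i`. -/
lemma pathEv_transport (hσ : σ ≫ leibniz I p = 𝟙 _) {V : C}
    (x : V ⟶ (pathTimes I).obj X) (i : V ⟶ I) (a : V ⟶ A) (h : a ≫ p = pathEv (x ≫ pathPr I X) i) :
    pathEv (transport σ x i a h ≫ pathPr I A) i = a := by
  have h₀ : a ≫ p = pathPair (x ≫ pathPr I X) i ≫ (evalI I).app X := by rw [h, pathPair_evalI]
  have e : sectionAt σ a (pathPair (x ≫ pathPr I X) i) h₀ ≫ timePr I A = i := by
    rw [← pathTimes_map_timePr I p, ← Category.assoc, sectionAt_map hσ, pathPair_timePr]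
  have := sectionAt_evalI hσ a _ h₀
  rw [comp_evalI, e] at this
  rw [transport, resetTime_pathPr, this]

lemma comp_transport {V V' : C} (t : V' ⟶ V)
    (x : V ⟶ (pathTimes I).obj X) (i : V ⟶ I) (a : V ⟶ A) (h : a ≫ p = pathEv (x ≫ pathPr I X) i) :
    t ≫ transport σ x i a h = transport σ (t ≫ x) (t ≫ i) (t ≫ a)
      (by rw [Category.assoc, h, comp_pathEv, Category.assoc]) := by
  rw [transport, transport, comp_resetTime, comp_sectionAt]
  congr 1
  exact sectionAt_congr _ rfl (by rw [comp_pathPair, Category.assoc])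

lemma transport_congr {V : C} {x x' : V ⟶ (pathTimes I).obj X} {i i' : V ⟶ I} {a a' : V ⟶ A}
    {h : a ≫ p = pathEv (x ≫ pathPr I X) i} {h' : a' ≫ p = pathEv (x' ≫ pathPr I X) i'}
    (hx : x = x') (hi : i = i') (ha : a = a') : transport σ x i a h = transport σ x' i' a' h' := by
  subst hx hi ha
  rfl

/-- The map that takes `s` over `(x, k)` to the path `j ↦ (a ↦ s(σ(a, x, j))(j))`, with time `k`.
Two transpositions are nested: first over `a`, with `s` and `j` generic, then over `j`. -/
lemma exists_retrDom (hσ : σ ≫ leibniz I p = 𝟙 _) :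
    ∃ m : (pushDom I q p).left ⟶ (pathTimes I).obj (push q p).left,
      m ≫ (pathTimes I).map (push q p).hom = (pushDom I q p).hom ∧
      ∀ {V : C} (s : V ⟶ (pushDom I q p).left) (i : V ⟶ I) (a : V ⟶ A)
        (h : (pathEv (s ≫ m ≫ pathPr I _) i) ≫ (push q p).hom = a ≫ p)
        (h' : a ≫ p = pathEv ((s ≫ (pushDom I q p).hom) ≫ pathPr I X) i),
        pushApp q p (pathEv (s ≫ m ≫ pathPr I _) i) a h =
          pathEv (domApp I q p s (transport σ (s ≫ (pushDom I q p).hom) i a h')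
            (transport_map hσ _ _ _ _) ≫ pathPr I B) i := by
  let D := (pushDom I q p).left
  -- The point `x(j)` for the generic pair of an element `s` over `x` and a time `j`; `j` is
  -- independent of the time component of `x`.
  let w : (timesI I).obj D ⟶ X :=
    pathEv ((timesIPr I D ≫ (pushDom I q p).hom) ≫ pathPr I X) (timesISnd I D)
  have hV := isPullback w p
  have h₀ : snd w p ≫ p = pathEv (((fst w p ≫ timesIPr I D) ≫ (pushDom I q p).hom) ≫ pathPr I X)
      (fst w p ≫ timesISnd I D) := by
    rw [← hV.w, comp_pathEv]
    simp only [Category.assoc]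
  obtain ⟨g, hg, e⟩ := exists_push_lift q p hV
    (pathEv (domApp I q p (fst w p ≫ timesIPr I D)
      (transport σ ((fst w p ≫ timesIPr I D) ≫ (pushDom I q p).hom) (fst w p ≫ timesISnd I D)
        (snd w p) h₀) (transport_map hσ _ _ _ _) ≫ pathPr I B) (fst w p ≫ timesISnd I D))
    (by
      rw [← pathEv_map, Category.assoc, domApp_pathPr]
      exact pathEv_transport hσ _ _ _ _)
  obtain ⟨γ, hγ⟩ := exists_path I g
  have hw : ∀ {V : C} (s : V ⟶ D) (i : V ⟶ I),
      timesLift s i ≫ w = pathEv ((s ≫ (pushDom I q p).hom) ≫ pathPr I X) i := by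
    intro V s i
    rw [comp_pathEv, ← Category.assoc, ← Category.assoc, timesLift_fst, timesLift_snd]
  -- The transposed path is paired with the original time component of `s`.
  refine ⟨pathPair γ ((pushDom I q p).hom ≫ timePr I X), ?_, fun s i a h h' => ?_⟩
  · rw [pathPair_map]
    apply pathTimes_ext
    · rw [pathPair_pathPr]
      apply path_ext
      intro V s i
      rw [← Category.assoc, pathEv_map, hγ, Category.assoc, hg, hw, Category.assoc]
    · rw [pathPair_timePr]
  · have h₁ : (timesLift s i ≫ g) ≫ (push q p).hom = a ≫ p := by
      rw [Category.assoc, hg, hw, h']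
    refine (pushApp_congr q p ?_ rfl (h' := h₁)).trans ?_
    · rw [pathPair_pathPr, hγ]
    have l₁ : hV.lift (timesLift s i) a (by rw [hw, h']) ≫ fst w p ≫ timesIPr I D = s := by
      rw [← Category.assoc, hV.lift_fst, timesLift_fst]
    have l₂ : hV.lift (timesLift s i) a (by rw [hw, h']) ≫ fst w p ≫ timesISnd I D = i := by
      rw [← Category.assoc, hV.lift_fst, timesLift_snd]
    rw [e (timesLift s i) a h₁ (by rw [hw, h']), comp_pathEv, l₂, ← Category.assoc, domApp,
      comp_pushApp]
    congr 2
    apply pushApp_congr _ _ l₁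
    rw [comp_transport]
    apply transport_congr
    · rw [← Category.assoc, l₁]
    · exact l₂
    · rw [hV.lift_snd]

/-- The retraction onto the domain of `δ ⇒ p_* q` determined by a section of `δ ⇒ p`. -/
noncomputable def retrDom (hσ : σ ≫ leibniz I p = 𝟙 _) :
    (pushDom I q p).left ⟶ (pathTimes I).obj (push q p).left :=
  (exists_retrDom q hσ).choose

lemma retrDom_map (hσ : σ ≫ leibniz I p = 𝟙 _) :
    retrDom q hσ ≫ (pathTimes I).map (push q p).hom = (pushDom I q p).hom :=
  (exists_retrDom q hσ).choose_spec.1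

lemma pushApp_retrDom (hσ : σ ≫ leibniz I p = 𝟙 _) {V : C} (s : V ⟶ (pushDom I q p).left)
    (i : V ⟶ I) (a : V ⟶ A)
    (h : (pathEv (s ≫ retrDom q hσ ≫ pathPr I _) i) ≫ (push q p).hom = a ≫ p)
    (h' : a ≫ p = pathEv ((s ≫ (pushDom I q p).hom) ≫ pathPr I X) i) :
    pushApp q p (pathEv (s ≫ retrDom q hσ ≫ pathPr I _) i) a h =
      pathEv (domApp I q p s (transport σ (s ≫ (pushDom I q p).hom) i a h')
        (transport_map hσ _ _ _ _) ≫ pathPr I B) i :=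
  (exists_retrDom q hσ).choose_spec.2 s i a h h'

end Retraction

/-! ### The retract diagram: `δ ⇒ p_* q` as a retract of the pushforward of `δ ⇒ q` -/

section RetractEquations

open ChosenPullbacksAlong ExponentiableMorphism

variable {C : Type u} [Category.{v} C] [HasTerminal C] [ChosenPullbacks C] [ChosenPushforwards C]
  {I : C} {B A X : C} (q : B ⟶ A) {p : A ⟶ X}
  {σ : pullbackObj p ((evalI I).app X) ⟶ (pathTimes I).obj A}

/-- The composite takes `y` to `a ↦ y(σ(a, x, i)(i))`, and `σ(a, x, i)(i) = a`. -/
lemma inclCod_retrCod (hσ : σ ≫ leibniz I p = 𝟙 _) : inclCod I q p ≫ retrCod q hσ = 𝟙 _ := by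
  have hs : (inclCod I q p ≫ retrCod q hσ) ≫ snd (push q p).hom ((evalI I).app X) =
      snd (push q p).hom ((evalI I).app X) := by
    rw [Category.assoc, retrCod_snd, inclCod_hom]
  apply ChosenPullbacksAlong.hom_ext
  · rw [Category.id_comp]
    apply push_ext
    swap
    · intro V t a h h'
      have h₁ : a ≫ p = ((t ≫ inclCod I q p) ≫ (pushCod I q p).hom) ≫ (evalI I).app X := by
        rw [← h', Category.assoc, condition, Category.assoc t, inclCod_hom, Category.assoc]
      refine (pushApp_congr q p (by simp only [Category.assoc]) rfl).trans
        ((pushApp_retrCod q hσ (t ≫ inclCod I q p) a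
          (by rw [← h]; simp only [Category.assoc]) h₁).trans ?_)
      rw [codApp_inclCod I q p t _ _ (by
        rw [sectionAt_map hσ, Category.assoc, inclCod_hom]), lift_fst _ _ _]
      apply pushApp_congr _ _ rfl
      rw [sectionAt_evalI hσ]
    · rw [Category.assoc, condition, ← Category.assoc, hs]
  · rw [hs, Category.id_comp]

/-- At time `j` the composite takes `y` to `a ↦ y(j)(σ(a, x, j)(j))`, and `σ(a, x, j)(j) = a`. Times
agree because both maps lie over `X^I × I`. -/
lemma inclDom_retrDom (hσ : σ ≫ leibniz I p = 𝟙 _) : inclDom I q p ≫ retrDom q hσ = 𝟙 _ := by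
  have hs : (inclDom I q p ≫ retrDom q hσ) ≫ (pathTimes I).map (push q p).hom =
      (pathTimes I).map (push q p).hom := by
    rw [Category.assoc, retrDom_map, inclDom_hom]
  apply pathTimes_ext
  · rw [Category.id_comp]
    apply path_ext
    intro V t i
    have hp : pathEv (t ≫ (inclDom I q p ≫ retrDom q hσ) ≫ pathPr I _) i ≫ (push q p).hom =
        pathEv (t ≫ pathPr I _) i ≫ (push q p).hom := by
      rw [← pathEv_map, ← pathEv_map, Category.assoc, Category.assoc _ (pathPr I _),
        ← pathTimes_map_pathPr, ← Category.assoc _ _ (pathPr I _), hs, pathTimes_map_pathPr,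
        Category.assoc]
    apply push_ext _ _ hp
    intro V' t' a h h'
    simp only [comp_pathEv] at h h' ⊢
    have h₁ : a ≫ p = pathEv (((t' ≫ t ≫ inclDom I q p) ≫ (pushDom I q p).hom) ≫ pathPr I X)
        (t' ≫ i) := by
      rw [← h']
      simp only [Category.assoc]
      rw [← Category.assoc (inclDom I q p), inclDom_hom, pathTimes_map_pathPr, ← pathEv_map]
      simp only [Category.assoc]
    refine (pushApp_congr q p (by simp only [Category.assoc]) rfl).trans
      ((pushApp_retrDom q hσ (t' ≫ t ≫ inclDom I q p) (t' ≫ i) a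
        (by rw [← h]; simp only [Category.assoc]) h₁).trans ?_)
    have h₂ : (t' ≫ t) ≫ (pathTimes I).map (push q p).hom =
        transport σ ((t' ≫ t ≫ inclDom I q p) ≫ (pushDom I q p).hom) (t' ≫ i) a h₁ ≫
          (pathTimes I).map p := by
      rw [← transport_map hσ, ← inclDom_hom]
      simp only [Category.assoc]
    have h₃ := pathEv_domApp_inclDom I q p (t' ≫ t) _ (by
      rw [Category.assoc, inclDom_hom]; exact h₂) (t' ≫ i) (pathEv_w I p h₂ _)
    refine Eq.trans ?_ (h₃.trans ?_)
    · congr 2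
      exact pushApp_congr _ _ (Category.assoc _ _ _).symm rfl
    · apply pushApp_congr
      · rw [Category.assoc]
      · rw [pathEv_transport hσ]
  · rw [← pathTimes_map_timePr I (push q p).hom, ← Category.assoc, hs, Category.id_comp]

/-- For `y` with time `i`, both sides give at `α` the element `y(i)(α(i))` of `B`: pointwise
application followed by evaluation at `i` is application of `y(i)` to `α(i)`. -/
lemma leibniz_inclCod :
    leibniz I (push q p).hom ≫ inclCod I q p =
      inclDom I q p ≫ pushArrow (leibniz I q) (snd q ((evalI I).app A)) ((pathTimes I).map p) := by
  have e₁ : (leibniz I (push q p).hom ≫ inclCod I q p) ≫ (pushCod I q p).hom =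
      (pathTimes I).map (push q p).hom := by
    rw [Category.assoc, inclCod_hom, leibniz_snd]
  have e₂ : (inclDom I q p ≫ pushArrow (leibniz I q) (snd q ((evalI I).app A))
      ((pathTimes I).map p)) ≫ (pushCod I q p).hom = (pathTimes I).map (push q p).hom := by
    rw [Category.assoc, pushArrow_hom, inclDom_hom]
  apply push_ext _ _ (e₁.trans e₂.symm)
  intro V t α h h'
  have h₀ : t ≫ (pathTimes I).map (push q p).hom = α ≫ (pathTimes I).map p := by
    rw [← h, Category.assoc, e₁]
  have h₁ := codApp_inclCod I q p (t ≫ leibniz I (push q p).hom) α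
    (by rw [← h]; simp only [Category.assoc]) (by rw [Category.assoc, leibniz_snd, h₀])
  have h₂ : (t ≫ inclDom I q p) ≫ (pushDom I q p).hom = α ≫ (pathTimes I).map p := by
    rw [Category.assoc, inclDom_hom, h₀]
  have h₃ := pushApp_pushArrow (snd q ((evalI I).app A)) ((pathTimes I).map p) (leibniz I q)
    (t ≫ inclDom I q p) α (by rw [← h']; simp only [Category.assoc]) h₂
  refine (pushApp_congr _ _ (Category.assoc _ _ _).symm rfl).trans (h₁.trans ?_)
  refine Eq.trans ?_ (h₃.symm.trans (pushApp_congr _ _ (Category.assoc _ _ _) rfl))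
  apply ChosenPullbacksAlong.hom_ext
  · have hr : (domApp I q p (t ≫ inclDom I q p) α h₂ ≫ leibniz I q) ≫ fst q ((evalI I).app A) =
        pathEv (domApp I q p (t ≫ inclDom I q p) α h₂ ≫ pathPr I B)
          (domApp I q p (t ≫ inclDom I q p) α h₂ ≫ timePr I B) := by
      rw [Category.assoc, leibniz_fst, comp_evalI]
    rw [lift_fst _ _ _]
    refine Eq.trans ?_ hr.symm
    have ht : domApp I q p (t ≫ inclDom I q p) α h₂ ≫ timePr I B = α ≫ timePr I A :=
      domApp_timePr I q p _ _ _
    have h₄ := pathEv_domApp_inclDom I q p t α h₂ (α ≫ timePr I A) (pathEv_w I p h₀ _)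
    rw [ht]
    refine Eq.trans (pushApp_congr _ _ ?_ ?_) h₄.symm
    · rw [Category.assoc, leibniz_fst, comp_evalI, ← pathTimes_map_timePr I p,
        ← Category.assoc α, ← h₀, Category.assoc, pathTimes_map_timePr]
    · rw [comp_evalI]
  · rw [lift_snd _ _ _, Category.assoc]
    exact (pushApp_comp _ _ _ _ _).symm

/-- For `s` over `(x, i)`, both sides give the function `a ↦ s(σ(a, x, i))(i)`: the retracted path
is evaluated at the time `i` of `x` itself, where the formulas on domains and codomains agree. -/
lemma retrDom_leibniz (hσ : σ ≫ leibniz I p = 𝟙 _) :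
    retrDom q hσ ≫ leibniz I (push q p).hom =
      pushArrow (leibniz I q) (snd q ((evalI I).app A)) ((pathTimes I).map p) ≫ retrCod q hσ := by
  have es : (retrDom q hσ ≫ leibniz I (push q p).hom) ≫ snd (push q p).hom ((evalI I).app X) =
      (pushDom I q p).hom := by
    rw [Category.assoc, leibniz_snd, retrDom_map]
  have es' : (pushArrow (leibniz I q) (snd q ((evalI I).app A)) ((pathTimes I).map p) ≫
      retrCod q hσ) ≫ snd (push q p).hom ((evalI I).app X) = (pushDom I q p).hom := by
    rw [Category.assoc, retrCod_snd, pushArrow_hom]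
  apply ChosenPullbacksAlong.hom_ext
  · apply push_ext
    swap
    · intro V s a h h'
      have h₁ : a ≫ p = (s ≫ (pushDom I q p).hom) ≫ (evalI I).app X := by
        rw [← h, Category.assoc, Category.assoc, condition, ← Category.assoc (_ ≫ _) (snd _ _), es]
        exact (Category.assoc _ _ _).symm
      have h₂ : a ≫ p = pathEv ((s ≫ (pushDom I q p).hom) ≫ pathPr I X)
          (s ≫ (pushDom I q p).hom ≫ timePr I X) := by
        rw [h₁, comp_evalI]
        simp only [Category.assoc]
      have y₁ : s ≫ (retrDom q hσ ≫ leibniz I (push q p).hom) ≫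
          fst (push q p).hom ((evalI I).app X) =
          pathEv (s ≫ retrDom q hσ ≫ pathPr I _) (s ≫ (pushDom I q p).hom ≫ timePr I X) := by
        rw [Category.assoc, leibniz_fst, ← Category.assoc, comp_evalI, ← retrDom_map q hσ]
        simp only [Category.assoc, pathTimes_map_timePr]
      have l := pushApp_retrDom q hσ s (s ≫ (pushDom I q p).hom ≫ timePr I X) a
        (by rw [← y₁, h]) h₂
      have h₃ : a ≫ p = ((s ≫ pushArrow (leibniz I q) (snd q ((evalI I).app A))
          ((pathTimes I).map p)) ≫ (pushCod I q p).hom) ≫ (evalI I).app X := by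
        rw [h₁, Category.assoc s (pushArrow _ _ _), pushArrow_hom]
      have r := pushApp_retrCod q hσ (s ≫ pushArrow (leibniz I q) (snd q ((evalI I).app A))
        ((pathTimes I).map p)) a (by rw [← h']; simp only [Category.assoc]) h₃
      refine (pushApp_congr _ _ y₁ rfl).trans (l.trans ?_)
      refine Eq.trans ?_ (r.symm.trans (pushApp_congr _ _ (by simp only [Category.assoc]) rfl))
      have h₄ : s ≫ (pushDom I q p).hom = sectionAt σ a (s ≫ (pushDom I q p).hom) h₁ ≫
          (pathTimes I).map p := (sectionAt_map hσ _ _ _).symm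
      have r' : codApp I q p (s ≫ pushArrow (leibniz I q) (snd q ((evalI I).app A))
          ((pathTimes I).map p)) (sectionAt σ a _ h₃) (sectionAt_map hσ _ _ _).symm =
          domApp I q p s (sectionAt σ a (s ≫ (pushDom I q p).hom) h₁) h₄ ≫ leibniz I q := by
        refine Eq.trans (pushApp_congr _ _ rfl ?_) (pushApp_pushArrow _ _ _ s _ ?_ h₄)
        · apply sectionAt_congr _ rfl
          rw [Category.assoc, pushArrow_hom]
        · rw [Category.assoc, pushArrow_hom]; exact h₄
      rw [r', Category.assoc, leibniz_fst, comp_evalI]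
      have tm : domApp I q p s (sectionAt σ a (s ≫ (pushDom I q p).hom) h₁) h₄ ≫ timePr I B =
          s ≫ (pushDom I q p).hom ≫ timePr I X := by
        rw [domApp_timePr, ← pathTimes_map_timePr I p, ← Category.assoc, ← h₄, Category.assoc]
      rw [tm]
      congr 2
      apply pushApp_congr _ _ rfl
      rw [transport]
      -- At the time component of `x`, the path of `x` paired with that time is `x` again. Hence the
      -- reset of the time is trivial and the transport is the section itself.
      have : sectionAt σ a (pathPair ((s ≫ (pushDom I q p).hom) ≫ pathPr I X)
          (s ≫ (pushDom I q p).hom ≫ timePr I X)) (by rw [h₂, pathPair_evalI]) =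
          sectionAt σ a (s ≫ (pushDom I q p).hom) h₁ := by
        apply sectionAt_congr _ rfl
        rw [← Category.assoc s, pathPair_eta]
      rw [this, resetTime]
      conv_rhs => rw [← pathPair_eta I (sectionAt σ a (s ≫ (pushDom I q p).hom) h₁)]
      congr 1
      rw [← pathTimes_map_timePr I p, ← Category.assoc, ← h₄]
    · rw [Category.assoc, condition, ← Category.assoc, es, Category.assoc (_ ≫ _), condition,
        ← Category.assoc, es']
  · rw [es, es']

end RetractEquations

/-! ### Naturality of the inclusions and retractions in cartesian morphisms of pairs -/

section Naturality

open ChosenPullbacksAlong ExponentiableMorphism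

variable {C : Type u} [Category.{v} C] [HasTerminal C] [ChosenPullbacks C] [ChosenPushforwards C]
  (I : C)

/-- The functor that takes `(q, p)` to the triple that consists of `δ ⇒ q`, the projection of its
codomain, and `p^I × I`. -/
noncomputable def leibnizTriple : CartPair C ⥤ CartTriple C where
  obj S := ⟨leibniz I S.q, snd S.q ((evalI I).app S.A), (pathTimes I).map S.p⟩
  map f :=
    { d := (pathTimes I).map f.b
      b := leibnizBase I f.isPullback_q.w
      a := (pathTimes I).map f.a
      x := (pathTimes I).map f.x
      isPullback_r := isPullback_leibniz I f.isPullback_q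
      isPullback_q := isPullback_leibnizBase I f.isPullback_q
      isPullback_p := f.isPullback_p.map (pathTimes I) }
  map_id S := by
    apply CartTriple.Hom.ext
    · exact (pathTimes I).map_id _
    · exact leibnizBase_id I S.q (by simp)
    · exact (pathTimes I).map_id _
    · exact (pathTimes I).map_id _
  map_comp f g := by
    apply CartTriple.Hom.ext
    · exact (pathTimes I).map_comp _ _
    · exact leibnizBase_comp I f.isPullback_q.w g.isPullback_q.w (f ≫ g).isPullback_q.w
    · exact (pathTimes I).map_comp _ _
    · exact (pathTimes I).map_comp _ _

variable {I} {S T : CartPair C} (f : S ⟶ T)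

variable (I) in
/-- The action of a cartesian morphism of pairs on `pushCod`. -/
noncomputable def pushCodMap : (pushCod I S.q S.p).left ⟶ (pushCod I T.q T.p).left :=
  pushMap (CartTriple.Hom.pair ((leibnizTriple I).map f))

variable (I) in
/-- The action of a cartesian morphism of pairs on `pushDom`. -/
noncomputable def pushDomMap : (pushDom I S.q S.p).left ⟶ (pushDom I T.q T.p).left :=
  pushMap (CartTriple.Hom.compPair ((leibnizTriple I).map f))

lemma pushCodMap_hom : pushCodMap I f ≫ (pushCod I T.q T.p).hom =
    (pushCod I S.q S.p).hom ≫ (pathTimes I).map f.x :=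
  pushMap_hom (CartTriple.Hom.pair ((leibnizTriple I).map f))

lemma pushDomMap_hom : pushDomMap I f ≫ (pushDom I T.q T.p).hom =
    (pushDom I S.q S.p).hom ≫ (pathTimes I).map f.x :=
  pushMap_hom (CartTriple.Hom.compPair ((leibnizTriple I).map f))

lemma codApp_pushCodMap {V : C} (s : V ⟶ (pushCod I S.q S.p).left)
    (α : V ⟶ (pathTimes I).obj S.A) {α' : V ⟶ (pathTimes I).obj T.A}
    (hα : α' = α ≫ (pathTimes I).map f.a)
    (h : (s ≫ pushCodMap I f) ≫ (pushCod I T.q T.p).hom = α' ≫ (pathTimes I).map T.p)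
    (h' : s ≫ (pushCod I S.q S.p).hom = α ≫ (pathTimes I).map S.p) :
    codApp I T.q T.p (s ≫ pushCodMap I f) α' h =
      codApp I S.q S.p s α h' ≫ leibnizBase I f.isPullback_q.w :=
  pushApp_pushMap (CartTriple.Hom.pair ((leibnizTriple I).map f)) s α hα h h'

lemma domApp_pushDomMap {V : C} (s : V ⟶ (pushDom I S.q S.p).left)
    (α : V ⟶ (pathTimes I).obj S.A) {α' : V ⟶ (pathTimes I).obj T.A}
    (hα : α' = α ≫ (pathTimes I).map f.a)
    (h : (s ≫ pushDomMap I f) ≫ (pushDom I T.q T.p).hom = α' ≫ (pathTimes I).map T.p)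
    (h' : s ≫ (pushDom I S.q S.p).hom = α ≫ (pathTimes I).map S.p) :
    domApp I T.q T.p (s ≫ pushDomMap I f) α' h =
      domApp I S.q S.p s α h' ≫ (pathTimes I).map f.b :=
  pushApp_pushMap (CartTriple.Hom.compPair ((leibnizTriple I).map f)) s α hα h h'

/-- For naturality squares, whose base component comes from `S`, it suffices to test on paths in `A`
that come from `S`; there the actions of `f` are computed by `codApp_pushCodMap`. -/
lemma pushCod_ext_of_hom {W : C} {m m' : W ⟶ (pushCod I T.q T.p).left}
    {w : W ⟶ (pathTimes I).obj S.X}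
    (hm : m ≫ (pushCod I T.q T.p).hom = w ≫ (pathTimes I).map f.x)
    (hm' : m' ≫ (pushCod I T.q T.p).hom = w ≫ (pathTimes I).map f.x)
    (e : ∀ {V : C} (t : V ⟶ W) (α : V ⟶ (pathTimes I).obj S.A)
      (_ : t ≫ w = α ≫ (pathTimes I).map S.p)
      (h : (t ≫ m) ≫ (pushCod I T.q T.p).hom =
        (α ≫ (pathTimes I).map f.a) ≫ (pathTimes I).map T.p)
      (h' : (t ≫ m') ≫ (pushCod I T.q T.p).hom =
        (α ≫ (pathTimes I).map f.a) ≫ (pathTimes I).map T.p),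
      codApp I T.q T.p (t ≫ m) (α ≫ (pathTimes I).map f.a) h =
        codApp I T.q T.p (t ≫ m') (α ≫ (pathTimes I).map f.a) h') : m = m' :=
  push_ext_of_hom (CartTriple.Hom.pair ((leibnizTriple I).map f)) hm hm' e

lemma pushDom_ext_of_hom {W : C} {m m' : W ⟶ (pushDom I T.q T.p).left}
    {w : W ⟶ (pathTimes I).obj S.X}
    (hm : m ≫ (pushDom I T.q T.p).hom = w ≫ (pathTimes I).map f.x)
    (hm' : m' ≫ (pushDom I T.q T.p).hom = w ≫ (pathTimes I).map f.x)
    (e : ∀ {V : C} (t : V ⟶ W) (α : V ⟶ (pathTimes I).obj S.A)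
      (_ : t ≫ w = α ≫ (pathTimes I).map S.p)
      (h : (t ≫ m) ≫ (pushDom I T.q T.p).hom =
        (α ≫ (pathTimes I).map f.a) ≫ (pathTimes I).map T.p)
      (h' : (t ≫ m') ≫ (pushDom I T.q T.p).hom =
        (α ≫ (pathTimes I).map f.a) ≫ (pathTimes I).map T.p),
      domApp I T.q T.p (t ≫ m) (α ≫ (pathTimes I).map f.a) h =
        domApp I T.q T.p (t ≫ m') (α ≫ (pathTimes I).map f.a) h') : m = m' :=
  push_ext_of_hom (CartTriple.Hom.compPair ((leibnizTriple I).map f)) hm hm' e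

/-- Only application and evaluation of paths occur in the inclusion, and both commute with `f`; no
section is involved. -/
lemma inclCod_naturality :
    inclCod I S.q S.p ≫ pushCodMap I f = leibnizBase I (pushMap_hom f) ≫ inclCod I T.q T.p := by
  have e₁ : (inclCod I S.q S.p ≫ pushCodMap I f) ≫ (pushCod I T.q T.p).hom =
      snd (push S.q S.p).hom ((evalI I).app S.X) ≫ (pathTimes I).map f.x := by
    rw [Category.assoc, pushCodMap_hom, ← Category.assoc, inclCod_hom]
  have e₂ : (leibnizBase I (pushMap_hom f) ≫ inclCod I T.q T.p) ≫ (pushCod I T.q T.p).hom =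
      snd (push S.q S.p).hom ((evalI I).app S.X) ≫ (pathTimes I).map f.x := by
    rw [Category.assoc, inclCod_hom, leibnizBase_snd]
  refine pushCod_ext_of_hom f e₁ e₂ ?_
  intro V t α hα h h'
  have l₁ := codApp_pushCodMap f (t ≫ inclCod I S.q S.p) α rfl
    (by rw [← h]; simp only [Category.assoc]) (by rw [Category.assoc, inclCod_hom, hα])
  have l₂ := codApp_inclCod I S.q S.p t α (by rw [Category.assoc, inclCod_hom, hα]) hα
  have hα' : (t ≫ leibnizBase I (pushMap_hom f)) ≫ snd (push T.q T.p).hom ((evalI I).app T.X) =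
      (α ≫ (pathTimes I).map f.a) ≫ (pathTimes I).map T.p := by
    rw [Category.assoc, leibnizBase_snd, ← Category.assoc, hα, Category.assoc, Category.assoc,
      ← Functor.map_comp, ← Functor.map_comp, f.isPullback_p.w]
  have r := codApp_inclCod I T.q T.p (t ≫ leibnizBase I (pushMap_hom f))
    (α ≫ (pathTimes I).map f.a) (by rw [← h']; simp only [Category.assoc]) hα'
  refine (pushApp_congr _ _ (Category.assoc _ _ _).symm rfl).trans (l₁.trans ?_)
  refine Eq.trans ?_ (r.symm.trans (pushApp_congr _ _ (Category.assoc _ _ _) rfl))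
  rw [l₂]
  apply ChosenPullbacksAlong.hom_ext
  · rw [Category.assoc, leibnizBase_fst, ← Category.assoc, lift_fst _ _ _, lift_fst _ _ _]
    refine (pushApp_pushMap f _ _ ?_ ?_ _).symm.trans (pushApp_congr _ _ ?_ rfl)
    · have e : (pathTimes I).map f.a ≫ (evalI I).app T.A = (evalI I).app S.A ≫ f.a :=
        (evalI I).naturality f.a
      rw [Category.assoc, e]
      exact (Category.assoc _ _ _).symm
    · rw [Category.assoc t, ← leibnizBase_fst I (pushMap_hom f), ← Category.assoc]
      exact inclCod_w I T.q T.p hα'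
    · rw [Category.assoc, Category.assoc, leibnizBase_fst]
  · rw [Category.assoc, leibnizBase_snd, ← Category.assoc, lift_snd _ _ _, lift_snd _ _ _]

lemma inclDom_naturality :
    inclDom I S.q S.p ≫ pushDomMap I f =
      (pathTimes I).map (pushMap f) ≫ inclDom I T.q T.p := by
  have e₁ : (inclDom I S.q S.p ≫ pushDomMap I f) ≫ (pushDom I T.q T.p).hom =
      (pathTimes I).map (push S.q S.p).hom ≫ (pathTimes I).map f.x := by
    rw [Category.assoc, pushDomMap_hom, ← Category.assoc, inclDom_hom]
  have e₂ : ((pathTimes I).map (pushMap f) ≫ inclDom I T.q T.p) ≫ (pushDom I T.q T.p).hom =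
      (pathTimes I).map (push S.q S.p).hom ≫ (pathTimes I).map f.x := by
    rw [Category.assoc, inclDom_hom, ← Functor.map_comp, ← Functor.map_comp, pushMap_hom]
  refine pushDom_ext_of_hom f e₁ e₂ ?_
  intro V t α hα h h'
  have l₁ := domApp_pushDomMap f (t ≫ inclDom I S.q S.p) α rfl
    (by rw [← h]; simp only [Category.assoc]) (by rw [Category.assoc, inclDom_hom, hα])
  refine (pushApp_congr _ _ (Category.assoc _ _ _).symm rfl).trans (l₁.trans ?_)
  have hα' : (t ≫ (pathTimes I).map (pushMap f)) ≫ (pathTimes I).map (push T.q T.p).hom =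
      (α ≫ (pathTimes I).map f.a) ≫ (pathTimes I).map T.p := by
    rw [Category.assoc, ← Functor.map_comp, pushMap_hom, Functor.map_comp, ← Category.assoc, hα,
      Category.assoc, Category.assoc, ← Functor.map_comp, ← Functor.map_comp, f.isPullback_p.w]
  have h'' : ((t ≫ (pathTimes I).map (pushMap f)) ≫ inclDom I T.q T.p) ≫ (pushDom I T.q T.p).hom =
      (α ≫ (pathTimes I).map f.a) ≫ (pathTimes I).map T.p := by
    rw [Category.assoc, inclDom_hom, hα']
  have hS : (t ≫ inclDom I S.q S.p) ≫ (pushDom I S.q S.p).hom = α ≫ (pathTimes I).map S.p := by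
    rw [Category.assoc, inclDom_hom, hα]
  suffices hs : domApp I S.q S.p (t ≫ inclDom I S.q S.p) α hS ≫ (pathTimes I).map f.b =
      domApp I T.q T.p ((t ≫ (pathTimes I).map (pushMap f)) ≫ inclDom I T.q T.p)
        (α ≫ (pathTimes I).map f.a) h'' from
    hs.trans (pushApp_congr _ _ (Category.assoc _ _ _) rfl)
  apply pathTimes_ext
  · apply path_ext
    intro V' s i
    rw [Category.assoc, pathTimes_map_pathPr, ← Category.assoc, ← Category.assoc, pathEv_map,
      ← Category.assoc s, domApp, domApp, comp_pushApp, comp_pushApp]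
    have hα₁ : (s ≫ t) ≫ (pathTimes I).map (push S.q S.p).hom =
        (s ≫ α) ≫ (pathTimes I).map S.p := by
      rw [Category.assoc, hα, Category.assoc]
    have hα₂ : (s ≫ t ≫ (pathTimes I).map (pushMap f)) ≫ (pathTimes I).map (push T.q T.p).hom =
        (s ≫ α ≫ (pathTimes I).map f.a) ≫ (pathTimes I).map T.p := by
      rw [Category.assoc, hα', ← Category.assoc]
    have l₂ := pathEv_domApp_inclDom I S.q S.p (s ≫ t) (s ≫ α)
      (by rw [Category.assoc, inclDom_hom, hα₁]) i (pathEv_w I S.p hα₁ i)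
    have r₂ := pathEv_domApp_inclDom I T.q T.p (s ≫ t ≫ (pathTimes I).map (pushMap f))
      (s ≫ α ≫ (pathTimes I).map f.a)
      (by rw [Category.assoc, inclDom_hom, hα₂]) i (pathEv_w I T.p hα₂ i)
    have c₁ : s ≫ t ≫ inclDom I S.q S.p = (s ≫ t) ≫ inclDom I S.q S.p :=
      (Category.assoc _ _ _).symm
    have c₂ : s ≫ (t ≫ (pathTimes I).map (pushMap f)) ≫ inclDom I T.q T.p =
        (s ≫ t ≫ (pathTimes I).map (pushMap f)) ≫ inclDom I T.q T.p :=
      (Category.assoc _ _ _).symm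
    refine Eq.trans (congrArg (fun m => pathEv (m ≫ pathPr I _) i ≫ f.b)
      (pushApp_congr _ _ c₁ rfl)) ((congrArg (· ≫ f.b) l₂).trans (Eq.trans ?_
        (r₂.symm.trans (congrArg (fun m => pathEv (m ≫ pathPr I _) i)
          (pushApp_congr _ _ c₂.symm rfl)))))
    have y : pathEv ((s ≫ t ≫ (pathTimes I).map (pushMap f)) ≫ pathPr I _) i =
        pathEv ((s ≫ t) ≫ pathPr I _) i ≫ pushMap f := by
      rw [← pathEv_map]
      simp only [Category.assoc, pathTimes_map_pathPr]
    have z : pathEv ((s ≫ α ≫ (pathTimes I).map f.a) ≫ pathPr I _) i =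
        pathEv ((s ≫ α) ≫ pathPr I _) i ≫ f.a := by
      rw [← pathEv_map]
      simp only [Category.assoc, pathTimes_map_pathPr]
    refine (pushApp_pushMap f _ _ z ?_ _).symm.trans (pushApp_congr _ _ y.symm rfl)
    rw [← y]
    exact pathEv_w I T.p hα₂ i
  · rw [Category.assoc, pathTimes_map_timePr, domApp_timePr, domApp_timePr, Category.assoc,
      pathTimes_map_timePr]

variable {σ : pullbackObj S.p ((evalI I).app S.X) ⟶ (pathTimes I).obj S.A}
  {τ : pullbackObj T.p ((evalI I).app T.X) ⟶ (pathTimes I).obj T.A}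

/-- The hypothesis `hστ`, compatibility of the chosen sections with the square on `p`, read as: path
lifting commutes with `f`. -/
lemma sectionAt_naturality
    (hστ : σ ≫ (pathTimes I).map f.a = leibnizBase I f.isPullback_p.w ≫ τ) {V : C}
    (a : V ⟶ S.A) (x : V ⟶ (pathTimes I).obj S.X) (h : a ≫ S.p = x ≫ (evalI I).app S.X)
    (h' : (a ≫ f.a) ≫ T.p = (x ≫ (pathTimes I).map f.x) ≫ (evalI I).app T.X) :
    sectionAt τ (a ≫ f.a) (x ≫ (pathTimes I).map f.x) h' =
      sectionAt σ a x h ≫ (pathTimes I).map f.a := by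
  rw [sectionAt, sectionAt, Category.assoc, hστ, ← Category.assoc]
  congr 1
  apply ChosenPullbacksAlong.hom_ext
  · rw [Category.assoc, leibnizBase_fst, ← Category.assoc, lift_fst _ _ _, lift_fst _ _ _]
  · rw [Category.assoc, leibnizBase_snd, ← Category.assoc, lift_snd _ _ _, lift_snd _ _ _]

lemma transport_naturality
    (hστ : σ ≫ (pathTimes I).map f.a = leibnizBase I f.isPullback_p.w ≫ τ) {V : C}
    (x : V ⟶ (pathTimes I).obj S.X) (i : V ⟶ I) (a : V ⟶ S.A)
    (h : a ≫ S.p = pathEv (x ≫ pathPr I S.X) i)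
    (h' : (a ≫ f.a) ≫ T.p = pathEv ((x ≫ (pathTimes I).map f.x) ≫ pathPr I T.X) i) :
    transport τ (x ≫ (pathTimes I).map f.x) i (a ≫ f.a) h' =
      transport σ x i a h ≫ (pathTimes I).map f.a := by
  have e : pathPair ((x ≫ (pathTimes I).map f.x) ≫ pathPr I T.X) i =
      pathPair (x ≫ pathPr I S.X) i ≫ (pathTimes I).map f.x := by
    rw [pathPair_map]
    simp only [Category.assoc, pathTimes_map_pathPr]
  have e' : (a ≫ f.a) ≫ T.p =
      (pathPair (x ≫ pathPr I S.X) i ≫ (pathTimes I).map f.x) ≫ (evalI I).app T.X := by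
    rw [← e, h', pathPair_evalI]
  rw [transport, transport, resetTime_map, ← sectionAt_naturality f hστ _ _ _ e', resetTime,
    resetTime]
  congr 1
  · exact congrArg (· ≫ pathPr I T.A) (sectionAt_congr τ rfl e)
  · rw [Category.assoc, pathTimes_map_timePr]

/-- Both sides apply `s` to a lifted path and map the result along `f`; the lifts correspond by
`sectionAt_naturality`. -/
lemma retrCod_naturality (hσ : σ ≫ leibniz I S.p = 𝟙 _) (hτ : τ ≫ leibniz I T.p = 𝟙 _)
    (hστ : σ ≫ (pathTimes I).map f.a = leibnizBase I f.isPullback_p.w ≫ τ) :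
    retrCod S.q hσ ≫ leibnizBase I (pushMap_hom f) = pushCodMap I f ≫ retrCod T.q hτ := by
  have s₁ : (retrCod S.q hσ ≫ leibnizBase I (pushMap_hom f)) ≫
      snd (push T.q T.p).hom ((evalI I).app T.X) =
      (pushCod I S.q S.p).hom ≫ (pathTimes I).map f.x := by
    rw [Category.assoc, leibnizBase_snd, ← Category.assoc, retrCod_snd]
  have s₂ : (pushCodMap I f ≫ retrCod T.q hτ) ≫
      snd (push T.q T.p).hom ((evalI I).app T.X) =
      (pushCod I S.q S.p).hom ≫ (pathTimes I).map f.x := by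
    rw [Category.assoc, retrCod_snd, pushCodMap_hom]
  have e : (pathTimes I).map f.x ≫ (evalI I).app T.X = (evalI I).app S.X ≫ f.x :=
    (evalI I).naturality f.x
  apply ChosenPullbacksAlong.hom_ext
  · refine push_ext_of_hom f (w := (pushCod I S.q S.p).hom ≫ (evalI I).app S.X) ?_ ?_ ?_
    · rw [Category.assoc, condition, ← Category.assoc, s₁, Category.assoc, e]
      exact (Category.assoc _ _ _).symm
    · rw [Category.assoc, condition, ← Category.assoc, s₂, Category.assoc, e]
      exact (Category.assoc _ _ _).symm
    intro V s a ha h h'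
    have ha₀ : a ≫ S.p = (s ≫ (pushCod I S.q S.p).hom) ≫ (evalI I).app S.X :=
      ha.symm.trans (Category.assoc _ _ _).symm
    have y : s ≫ (retrCod S.q hσ ≫ leibnizBase I (pushMap_hom f)) ≫
        fst (push T.q T.p).hom ((evalI I).app T.X) =
        (s ≫ retrCod S.q hσ ≫ fst (push S.q S.p).hom ((evalI I).app S.X)) ≫ pushMap f := by
      rw [Category.assoc, leibnizBase_fst]
      simp only [Category.assoc]
    have hS : (s ≫ retrCod S.q hσ ≫ fst (push S.q S.p).hom ((evalI I).app S.X)) ≫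
        (push S.q S.p).hom = a ≫ S.p := by
      rw [Category.assoc, Category.assoc, condition, ← Category.assoc (retrCod _ _), retrCod_snd,
        ha₀]
      exact (Category.assoc _ _ _).symm
    refine (pushApp_congr _ _ y rfl (h' := by rw [← y, h])).trans
      ((pushApp_pushMap f _ a rfl _ hS).trans ?_)
    rw [pushApp_retrCod S.q hσ s a hS ha₀]
    have ha₁ : (a ≫ f.a) ≫ T.p =
        ((s ≫ pushCodMap I f) ≫ (pushCod I T.q T.p).hom) ≫ (evalI I).app T.X := by
      rw [Category.assoc, f.isPullback_p.w, ← Category.assoc, ha₀,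
        Category.assoc s (pushCodMap I f), pushCodMap_hom, Category.assoc, Category.assoc,
        Category.assoc, Category.assoc, e]
    refine Eq.trans ?_ ((pushApp_retrCod T.q hτ (s ≫ pushCodMap I f) (a ≫ f.a)
      (by rw [← h']; simp only [Category.assoc]) ha₁).symm.trans
        (pushApp_congr _ _ (by simp only [Category.assoc]) rfl))
    have hc : codApp I T.q T.p (s ≫ pushCodMap I f) (sectionAt τ (a ≫ f.a) _ ha₁)
        (sectionAt_map hτ _ _ _).symm = codApp I S.q S.p s (sectionAt σ a _ ha₀)
          (sectionAt_map hσ _ _ _).symm ≫ leibnizBase I f.isPullback_q.w := by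
      apply codApp_pushCodMap
      have ex : (s ≫ pushCodMap I f) ≫ (pushCod I T.q T.p).hom =
          (s ≫ (pushCod I S.q S.p).hom) ≫ (pathTimes I).map f.x := by
        rw [Category.assoc, pushCodMap_hom, Category.assoc]
      rw [← sectionAt_naturality f hστ _ _ _ (by rw [← ex, ha₁])]
      exact sectionAt_congr τ rfl ex
    rw [hc, Category.assoc, Category.assoc, leibnizBase_fst]
  · rw [s₁, s₂]

/-- As for `retrCod_naturality`, at each time `j` of the resulting path, with `transport_naturality`
for the lift through `a` at `j`. -/
lemma retrDom_naturality (hσ : σ ≫ leibniz I S.p = 𝟙 _) (hτ : τ ≫ leibniz I T.p = 𝟙 _)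
    (hστ : σ ≫ (pathTimes I).map f.a = leibnizBase I f.isPullback_p.w ≫ τ) :
    retrDom S.q hσ ≫ (pathTimes I).map (pushMap f) = pushDomMap I f ≫ retrDom T.q hτ := by
  have s₁ : (retrDom S.q hσ ≫ (pathTimes I).map (pushMap f)) ≫
      (pathTimes I).map (push T.q T.p).hom =
      (pushDom I S.q S.p).hom ≫ (pathTimes I).map f.x := by
    rw [Category.assoc, ← Functor.map_comp, pushMap_hom, Functor.map_comp, ← Category.assoc,
      retrDom_map]
  have s₂ : (pushDomMap I f ≫ retrDom T.q hτ) ≫ (pathTimes I).map (push T.q T.p).hom =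
      (pushDom I S.q S.p).hom ≫ (pathTimes I).map f.x := by
    rw [Category.assoc, retrDom_map, pushDomMap_hom]
  have hw : ∀ {m : (pushDom I S.q S.p).left ⟶ (pathTimes I).obj (push T.q T.p).left}
      (_ : m ≫ (pathTimes I).map (push T.q T.p).hom =
        (pushDom I S.q S.p).hom ≫ (pathTimes I).map f.x) {V : C}
      (t : V ⟶ (pushDom I S.q S.p).left) (i : V ⟶ I),
      pathEv (t ≫ m ≫ pathPr I _) i ≫ (push T.q T.p).hom =
        pathEv ((t ≫ (pushDom I S.q S.p).hom) ≫ pathPr I _) i ≫ f.x := by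
    intro m hm V t i
    rw [← pathEv_map, ← pathEv_map]
    simp only [Category.assoc]
    rw [← pathTimes_map_pathPr, ← pathTimes_map_pathPr, ← Category.assoc m, hm]
    simp only [Category.assoc]
  apply pathTimes_ext
  · apply path_ext
    intro W t i
    refine push_ext_of_hom f (hw s₁ t i) (hw s₂ t i) ?_
    intro V t' a ha h h'
    rw [comp_pathEv] at ha
    have ha₀ : a ≫ S.p = pathEv (((t' ≫ t) ≫ (pushDom I S.q S.p).hom) ≫ pathPr I S.X)
        (t' ≫ i) := by
      rw [← ha]
      simp only [Category.assoc]
    have y : t' ≫ pathEv (t ≫ (retrDom S.q hσ ≫ (pathTimes I).map (pushMap f)) ≫ pathPr I _) i =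
        pathEv ((t' ≫ t) ≫ retrDom S.q hσ ≫ pathPr I _) (t' ≫ i) ≫ pushMap f := by
      rw [comp_pathEv, ← pathEv_map]
      simp only [Category.assoc, pathTimes_map_pathPr]
    have y' : t' ≫ pathEv (t ≫ (pushDomMap I f ≫ retrDom T.q hτ) ≫ pathPr I _) i =
        pathEv (((t' ≫ t) ≫ pushDomMap I f) ≫ retrDom T.q hτ ≫ pathPr I _) (t' ≫ i) := by
      rw [comp_pathEv]
      simp only [Category.assoc]
    have hS : pathEv ((t' ≫ t) ≫ retrDom S.q hσ ≫ pathPr I _) (t' ≫ i) ≫ (push S.q S.p).hom =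
        a ≫ S.p := by
      rw [ha₀, ← retrDom_map S.q hσ, ← pathEv_map]
      simp only [Category.assoc, pathTimes_map_pathPr]
    refine (pushApp_congr _ _ y rfl (h' := by rw [← y, h])).trans
      ((pushApp_pushMap f _ a rfl _ hS).trans ?_)
    rw [pushApp_retrDom S.q hσ _ _ a hS ha₀]
    have ex : ((t' ≫ t) ≫ pushDomMap I f) ≫ (pushDom I T.q T.p).hom =
        ((t' ≫ t) ≫ (pushDom I S.q S.p).hom) ≫ (pathTimes I).map f.x := by
      rw [Category.assoc, pushDomMap_hom, Category.assoc _ (pushDom I S.q S.p).hom]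
    have ha₁ : (a ≫ f.a) ≫ T.p = pathEv ((((t' ≫ t) ≫ pushDomMap I f) ≫
        (pushDom I T.q T.p).hom) ≫ pathPr I T.X) (t' ≫ i) := by
      rw [ex, Category.assoc _ ((pathTimes I).map f.x), pathTimes_map_pathPr, ← Category.assoc,
        pathEv_map, ← ha₀, Category.assoc, f.isPullback_p.w, Category.assoc]
    refine Eq.trans ?_ ((pushApp_retrDom T.q hτ ((t' ≫ t) ≫ pushDomMap I f) (t' ≫ i) (a ≫ f.a)
      (by rw [← y', h']) ha₁).symm.trans (pushApp_congr _ _ y'.symm rfl))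
    have hc : domApp I T.q T.p ((t' ≫ t) ≫ pushDomMap I f) (transport τ _ _ (a ≫ f.a) ha₁)
        (transport_map hτ _ _ _ _) = domApp I S.q S.p (t' ≫ t) (transport σ _ _ a ha₀)
          (transport_map hσ _ _ _ _) ≫ (pathTimes I).map f.b := by
      apply domApp_pushDomMap
      rw [← transport_naturality f hστ _ _ _ _ (by rw [← ex, ha₁])]
      exact transport_congr ex rfl rfl
    rw [hc, ← pathEv_map]
    simp only [Category.assoc, pathTimes_map_pathPr]
  · rw [← pathTimes_map_timePr I (push T.q T.p).hom, ← Category.assoc, s₁, ← Category.assoc, s₂]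

end Naturality

/-! ### Functors for which all arrows are cartesian -/

section DiscreteFibrations

variable {𝒮 : Type u} [Category.{v} 𝒮]
variable {𝒳 : Type u₁} [Category.{v₁} 𝒳] {𝒴 : Type u₂} [Category.{v₂} 𝒴]

/-- All arrows of `𝒳` are cartesian with respect to `p : 𝒳 ⥤ 𝒮`. -/
def AllCartesian (p : 𝒳 ⥤ 𝒮) : Prop :=
  ∀ ⦃X Y Z : 𝒳⦄ (φ : X ⟶ Y) (ψ : Z ⟶ Y) (g : p.obj Z ⟶ p.obj X), g ≫ p.map φ = p.map ψ →
    ∃! χ : Z ⟶ X, p.map χ = g ∧ χ ≫ φ = ψ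

/-- Each arrow `R ⟶ p X` lifts to an arrow with codomain `X`. -/
def HasLifts (p : 𝒳 ⥤ 𝒮) : Prop :=
  ∀ (X : 𝒳) (R : 𝒮) (f : R ⟶ p.obj X), ∃ (Y : 𝒳) (φ : Y ⟶ X), p.IsHomLift f φ

lemma AllCartesian.cartesianArrows {p : 𝒳 ⥤ 𝒮} (h : AllCartesian p) {X Y : 𝒳} (φ : X ⟶ Y) :
    cartesianArrows p φ where
  universal_property' {Z} g ψ hψ := by
    have e : g ≫ p.map φ = p.map ψ := IsHomLift.eq_of_isHomLift p _ ψ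
    obtain ⟨χ, ⟨h₁, h₂⟩, h₃⟩ := h φ ψ g e
    refine ⟨χ, ⟨?_, h₂⟩, fun χ' ⟨h₁', h₂'⟩ => h₃ χ' ⟨?_, h₂'⟩⟩
    · subst h₁
      infer_instance
    · exact (IsHomLift.eq_of_isHomLift p g χ').symm

lemma AllCartesian.isFibered {p : 𝒳 ⥤ 𝒮} (h : AllCartesian p) (hl : HasLifts p) :
    p.IsFibered := by
  refine .of_exists_isStronglyCartesian fun X R f => ?_
  obtain ⟨Y, φ, hφ⟩ := hl X R f
  obtain rfl := IsHomLift.domain_eq p f φ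
  obtain rfl := IsHomLift.eq_of_isHomLift p f φ
  exact ⟨Y, φ, h.cartesianArrows φ⟩

lemma AllCartesian.comp {F : 𝒳 ⥤ 𝒴} {p : 𝒴 ⥤ 𝒮} (hF : AllCartesian F) (hp : AllCartesian p) :
    AllCartesian (F ⋙ p) := by
  intro X Y Z φ ψ g e
  obtain ⟨χ, ⟨h₁, h₂⟩, h₃⟩ := hp (F.map φ) (F.map ψ) g e
  obtain ⟨ξ, ⟨k₁, k₂⟩, k₃⟩ := hF φ ψ χ h₂
  refine ⟨ξ, ⟨?_, k₂⟩, fun ξ' ⟨l₁, l₂⟩ => k₃ ξ' ⟨h₃ _ ⟨l₁, ?_⟩, l₂⟩⟩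
  · exact (congrArg p.map k₁).trans h₁
  · rw [← F.map_comp, l₂]

lemma HasLifts.comp {F : 𝒳 ⥤ 𝒴} {p : 𝒴 ⥤ 𝒮} (hF : HasLifts F) (hp : HasLifts p) :
    HasLifts (F ⋙ p) := by
  intro X R f
  obtain ⟨Y, φ, hφ⟩ := hp (F.obj X) R f
  obtain rfl := IsHomLift.domain_eq p f φ
  obtain rfl := IsHomLift.eq_of_isHomLift p f φ
  obtain ⟨Z, ψ, hψ⟩ := hF X Y φ
  obtain rfl := IsHomLift.domain_eq F φ ψ
  obtain rfl := IsHomLift.eq_of_isHomLift F φ ψ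
  exact ⟨Z, ψ, IsHomLift.map (F ⋙ p) ψ⟩

lemma IsDiscreteFibration.hasLifts {F : 𝒳 ⥤ 𝒴} (hF : IsDiscreteFibration F) : HasLifts F := by
  intro X R f
  obtain ⟨e, he, -⟩ := hF X R f
  exact ⟨e.1, e.2, he⟩

/-- A lift `χ` of `g` with codomain `X` exists and is unique. Then `χ ≫ φ` and `ψ` are two lifts of
the same arrow with codomain `Y`, so they coincide, domains included. -/
lemma IsDiscreteFibration.allCartesian {F : 𝒳 ⥤ 𝒴} (hF : IsDiscreteFibration F) :
    AllCartesian F := by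
  intro X Y Z φ ψ g e
  have key : ∀ {W : 𝒳} (χ : W ⟶ X), F.IsHomLift g χ →
      (⟨W, χ ≫ φ⟩ : Σ d' : 𝒳, (d' ⟶ Y)) = ⟨Z, ψ⟩ := by
    intro W χ hχ
    refine (hF Y _ (F.map ψ)).unique ?_ (IsHomLift.map F ψ)
    rw [← e]
    exact IsHomLift.comp F g (F.map φ) χ φ
  obtain ⟨⟨W, χ⟩, hχ, hu⟩ := hF X _ g
  have hk := key χ hχ
  obtain rfl : W = Z := congrArg Sigma.fst hk
  refine ⟨χ, ⟨(IsHomLift.eq_of_isHomLift F g χ).symm, by simpa using hk⟩, ?_⟩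
  rintro χ' ⟨rfl, -⟩
  simpa using hu ⟨_, χ'⟩ (IsHomLift.map F χ')

end DiscreteFibrations

/-! ### Discrete fibrations under strict pullback and products -/

section StrictPullback

variable {𝒜 : Type u₁} [Category.{v₁} 𝒜] {ℬ : Type u₂} [Category.{v₂} ℬ]
variable {𝒞 : Type u₃} [Category.{v₃} 𝒞] {𝒟 : Type u₄} [Category.{v₄} 𝒟]

namespace StrictPullback

lemma isDiscreteFibration_π₁ (F : 𝒜 ⥤ 𝒞) {G : ℬ ⥤ 𝒞} (hG : IsDiscreteFibration G) :
    IsDiscreteFibration (π₁ F G) := by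
  rintro ⟨d₁, d₂, w⟩ b (f : b ⟶ d₁)
  -- The second component of the lift of `f` is the unique lift along `G` of the image of `f`, moved
  -- to `G.obj d₂` along the equality of objects.
  obtain ⟨⟨b', g⟩, hg, hu⟩ := hG d₂ (F.obj b) (F.map f ≫ eqToHom w)
  have e₁ : G.obj b' = F.obj b := IsHomLift.domain_eq G (F.map f ≫ eqToHom w) g
  have e₂ := IsHomLift.fac G (F.map f ≫ eqToHom w) g
  let X : StrictPullback F G := ⟨b, b', e₁.symm⟩
  let φ : X ⟶ ⟨d₁, d₂, w⟩ := ⟨f, g, by simpa using e₂⟩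
  refine ⟨⟨X, φ⟩, IsHomLift.map (π₁ F G) φ, ?_⟩
  rintro ⟨⟨c₁, c₂, w'⟩, ψ⟩ (hψ : (π₁ F G).IsHomLift f ψ)
  obtain rfl : c₁ = b := IsHomLift.domain_eq (π₁ F G) f ψ
  obtain rfl : f = ψ.fst :=
    @IsHomLift.eq_of_isHomLift _ _ _ _ (π₁ F G) ⟨c₁, c₂, w'⟩ ⟨d₁, d₂, w⟩ f ψ hψ
  clear hψ
  obtain ⟨ψ₁, ψ₂, hψ⟩ := ψ
  have := hu ⟨c₂, ψ₂⟩ (IsHomLift.of_fac G _ _ w'.symm rfl (by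
    simpa using hψ))
  cases this
  rfl

lemma isDiscreteFibration_π₂ {F : 𝒜 ⥤ 𝒞} (G : ℬ ⥤ 𝒞) (hF : IsDiscreteFibration F) :
    IsDiscreteFibration (π₂ F G) := by
  rintro ⟨d₁, d₂, w⟩ b (f : b ⟶ d₂)
  obtain ⟨⟨b', g⟩, hg, hu⟩ := hF d₁ (G.obj b) (G.map f ≫ eqToHom w.symm)
  have e₁ : F.obj b' = G.obj b := IsHomLift.domain_eq F (G.map f ≫ eqToHom w.symm) g
  have e₂ := IsHomLift.fac' F (G.map f ≫ eqToHom w.symm) g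
  let X : StrictPullback F G := ⟨b', b, e₁⟩
  let φ : X ⟶ ⟨d₁, d₂, w⟩ := ⟨g, f, by rw [e₂]; simp⟩
  refine ⟨⟨X, φ⟩, IsHomLift.map (π₂ F G) φ, ?_⟩
  rintro ⟨⟨c₁, c₂, w'⟩, ψ⟩ (hψ : (π₂ F G).IsHomLift f ψ)
  obtain rfl : c₂ = b := IsHomLift.domain_eq (π₂ F G) f ψ
  obtain rfl : f = ψ.snd :=
    @IsHomLift.eq_of_isHomLift _ _ _ _ (π₂ F G) ⟨c₁, c₂, w'⟩ ⟨d₁, d₂, w⟩ f ψ hψ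
  clear hψ
  obtain ⟨ψ₁, ψ₂, hψ⟩ := ψ
  have := hu ⟨c₁, ψ₁⟩ (IsHomLift.of_fac' F _ _ w' rfl (by
    dsimp only [π₂] at hψ ⊢
    rw [← Category.assoc, ← Category.assoc, ← hψ]
    simp))
  cases this
  rfl

/-- The functor into a strict pullback given by its components. -/
def lift {F : 𝒜 ⥤ 𝒞} {G : ℬ ⥤ 𝒞} (K : 𝒟 ⥤ 𝒜) (L : 𝒟 ⥤ ℬ) (h : K ⋙ F = L ⋙ G) :
    𝒟 ⥤ StrictPullback F G where
  obj X := ⟨K.obj X, L.obj X, Functor.congr_obj h X⟩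
  map f := ⟨K.map f, L.map f, by
    have := Functor.congr_hom h f
    dsimp only [Functor.comp_obj, Functor.comp_map] at this
    rw [this]
    simp⟩
  map_id X := by apply Hom.ext; exacts [K.map_id X, L.map_id X]
  map_comp f g := by apply Hom.ext; exacts [K.map_comp f g, L.map_comp f g]

lemma π₁_comp (F : 𝒜 ⥤ 𝒞) (G : ℬ ⥤ 𝒞) : π₁ F G ⋙ F = π₂ F G ⋙ G := by
  have key : ∀ {a b c d : 𝒞} (x : a ⟶ c) (y : b ⟶ d) (h₁ : a = b) (h₂ : c = d),
      x ≫ eqToHom h₂ = eqToHom h₁ ≫ y → x = eqToHom h₁ ≫ y ≫ eqToHom h₂.symm := by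
    intro a b c d x y h₁ h₂ h
    subst h₁ h₂
    simpa using h
  exact CategoryTheory.Functor.ext (fun X => X.w) fun X Y f => key _ _ X.w Y.w f.w

end StrictPullback

lemma IsDiscreteFibration.prod {F : 𝒜 ⥤ 𝒞} {G : ℬ ⥤ 𝒟} (hF : IsDiscreteFibration F)
    (hG : IsDiscreteFibration G) : IsDiscreteFibration (F.prod G) := by
  rintro ⟨d₁, d₂⟩ ⟨b₁, b₂⟩ ⟨f₁, f₂⟩
  obtain ⟨⟨c₁, g₁⟩, h₁, hu₁⟩ := hF d₁ b₁ f₁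
  obtain ⟨⟨c₂, g₂⟩, h₂, hu₂⟩ := hG d₂ b₂ f₂
  obtain rfl := IsHomLift.domain_eq F f₁ g₁
  obtain rfl := IsHomLift.eq_of_isHomLift F f₁ g₁
  obtain rfl := IsHomLift.domain_eq G f₂ g₂
  obtain rfl := IsHomLift.eq_of_isHomLift G f₂ g₂
  refine ⟨⟨(c₁, c₂), Prod.mkHom g₁ g₂⟩, IsHomLift.map (F.prod G) (Prod.mkHom g₁ g₂), ?_⟩
  rintro ⟨⟨e₁, e₂⟩, k⟩ (hk : (F.prod G).IsHomLift (Prod.mkHom (F.map g₁) (G.map g₂)) k)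
  have hd := IsHomLift.domain_eq (F.prod G) (Prod.mkHom (F.map g₁) (G.map g₂)) k
  have hf := IsHomLift.fac' (F.prod G) (Prod.mkHom (F.map g₁) (G.map g₂)) k
  have hd₁ : F.obj e₁ = F.obj c₁ := congrArg Prod.fst hd
  have hd₂ : G.obj e₂ = G.obj c₂ := congrArg Prod.snd hd
  have l₁ := hu₁ ⟨e₁, k.1⟩ (IsHomLift.of_fac' F _ _ hd₁ rfl (by
    simpa using congrArg Prod.fst hf))
  have l₂ := hu₂ ⟨e₂, k.2⟩ (IsHomLift.of_fac' G _ _ hd₂ rfl (by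
    simpa using congrArg Prod.snd hf))
  obtain ⟨k₁, k₂⟩ := k
  cases l₁
  cases l₂
  rfl

end StrictPullback

/-! ### The codomain functors on pullback squares and on cartesian morphisms of pairs -/

section Codomain

variable (C : Type u) [Category.{v} C]

variable {C} in
-- Pullback cancellation: a factorization on bases induces one on total objects, and the new square
-- is again a pullback. For pairs it is applied twice, to `p` and then to `q`.
lemma exists_isPullback_of_factors {A X A' X' A'' X'' : C} {p : A ⟶ X} {p' : A' ⟶ X'}
    {p'' : A'' ⟶ X''} {a' : A' ⟶ A} {x' : X' ⟶ X} {a'' : A'' ⟶ A} {x'' : X'' ⟶ X}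
    (h' : IsPullback a' p' p x') (h'' : IsPullback a'' p'' p x'') (g : X'' ⟶ X')
    (e : g ≫ x' = x'') : ∃ l : A'' ⟶ A', l ≫ a' = a'' ∧ IsPullback l p'' p' g := by
  have h : a'' ≫ p = (p'' ≫ g) ≫ x' := by rw [Category.assoc, e, h''.w]
  refine ⟨h'.lift a'' (p'' ≫ g) h, h'.lift_fst _ _ _, ?_⟩
  refine IsPullback.of_right (h₁₂ := a') (h₂₂ := x') (v₁₃ := p) ?_ (h'.lift_snd _ _ _) h'
  rw [h'.lift_fst, e]
  exact h''

lemma CartArrow.allCartesian_cod : AllCartesian (CartArrow.cod C) := by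
  intro X Y Z φ ψ g e
  obtain ⟨l, hl, hp⟩ := exists_isPullback_of_factors φ.property ψ.property g e
  refine ⟨⟨Arrow.homMk l g hp.w, hp⟩, ⟨rfl, ?_⟩, ?_⟩
  · apply WideSubcategory.hom_ext
    exact Arrow.hom_ext _ _ hl e
  · rintro χ ⟨rfl, rfl⟩
    apply WideSubcategory.hom_ext
    exact Arrow.hom_ext _ _ (φ.property.hom_ext hl.symm (χ.property.w.trans hp.w.symm)) rfl

lemma CartPair.allCartesian_cod : AllCartesian (CartPair.cod C) := by
  intro X Y Z φ ψ g e
  obtain ⟨a, ha, pa⟩ := exists_isPullback_of_factors φ.isPullback_p ψ.isPullback_p g e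
  obtain ⟨b, hb, pb⟩ := exists_isPullback_of_factors φ.isPullback_q ψ.isPullback_q a ha
  refine ⟨⟨b, a, g, pb, pa⟩, ⟨rfl, CartPair.Hom.ext hb ha e⟩, ?_⟩
  rintro χ ⟨rfl, rfl⟩
  have e₁ : χ.a = a := φ.isPullback_p.hom_ext ha.symm (χ.isPullback_p.w.trans pa.w.symm)
  refine CartPair.Hom.ext (φ.isPullback_q.hom_ext hb.symm (χ.isPullback_q.w.trans ?_)) e₁ rfl
  rw [e₁]
  exact pb.w.symm

variable [HasPullbacks C]

lemma CartArrow.hasLifts_cod : HasLifts (CartArrow.cod C) := by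
  intro X R (f : R ⟶ X.obj.right)
  let φ := CartArrow.homOf (IsPullback.of_hasPullback X.obj.hom f)
  exact ⟨_, φ, IsHomLift.map (CartArrow.cod C) φ⟩

lemma CartPair.hasLifts_cod : HasLifts (CartPair.cod C) := by
  intro X R (f : R ⟶ X.X)
  let φ : CartPair.mk _ _ ⟶ X := ⟨_, _, f, IsPullback.of_hasPullback X.q (pullback.fst X.p f),
    IsPullback.of_hasPullback X.p f⟩
  exact ⟨_, φ, IsHomLift.map (CartPair.cod C) φ⟩

end Codomain

/-! ### The functor of retract diagrams -/

section RetractFunctor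

open ChosenPullbacksAlong

variable {C : Type u} [Category.{v} C] {D : Type u₁} [Category.{v₁} D]

/-- Eliminating the equation of functors yields sections typed directly over `G`, without transport
along equalities of objects. -/
lemma exists_natural_section {G : D ⥤ CartArrow C} (s : D ⥤ CartSection C)
    (h : s ⋙ CartSection.arrow C = G) :
    ∃ σ : ∀ d, (G.obj d).obj.right ⟶ (G.obj d).obj.left,
      (∀ d, σ d ≫ (G.obj d).obj.hom = 𝟙 _) ∧
      ∀ {d d' : D} (f : d ⟶ d'), σ d ≫ (G.map f).hom.left = (G.map f).hom.right ≫ σ d' := by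
  subst h
  exact ⟨fun d => (s.obj d).obj.ret.i, fun d => (s.obj d).obj.ret.retract,
    fun f => (s.map f).hom.w_i⟩

variable [HasTerminal C] [ChosenPullbacks C] [ChosenPushforwards C] {I : C}

/-- `δ ⇒ p_* q` as a retract of the pushforward of `δ ⇒ q` along `p^I × I`. -/
noncomputable def leibnizRetract (S : CartPair C)
    {σ : pullbackObj S.p ((evalI I).app S.X) ⟶ (pathTimes I).obj S.A}
    (hσ : σ ≫ leibniz I S.p = 𝟙 _) :
    Retract (Arrow.mk (leibniz I (push S.q S.p).hom))
      (Arrow.mk (pushArrow (leibniz I S.q) (snd S.q ((evalI I).app S.A))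
        ((pathTimes I).map S.p))) where
  i := Arrow.homMk (inclDom I S.q S.p) (inclCod I S.q S.p) (leibniz_inclCod S.q).symm
  r := Arrow.homMk (retrDom S.q hσ) (retrCod S.q hσ) (retrDom_leibniz S.q hσ)
  retract := Arrow.hom_ext _ _ (inclDom_retrDom S.q hσ) (inclCod_retrCod S.q hσ)

/-- The functoriality of `leibnizRetract`. -/
noncomputable def leibnizRetractFunctor (K : D ⥤ CartPair C)
    (σ : ∀ d, pullbackObj (K.obj d).p ((evalI I).app (K.obj d).X) ⟶
      (pathTimes I).obj (K.obj d).A)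
    (hσ : ∀ d, σ d ≫ leibniz I (K.obj d).p = 𝟙 _)
    (hn : ∀ {d d' : D} (f : d ⟶ d'), σ d ≫ (pathTimes I).map (K.map f).a =
      leibnizBase I (K.map f).isPullback_p.w ≫ σ d') : D ⥤ CartRetract C where
  obj d := ⟨⟨leibnizRetract (K.obj d) (hσ d)⟩⟩
  map {d d'} f :=
    { hom :=
        { retr := ((pushPair ⋙ leibnizFunctor I).map (K.map f)).hom
          center := ((leibnizTriple I ⋙ pushTriple ⋙ CartPair.ev01 C).map (K.map f)).hom
          w_i := Arrow.hom_ext _ _ (inclDom_naturality (K.map f)) (inclCod_naturality (K.map f))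
          w_r := Arrow.hom_ext _ _ (retrDom_naturality (K.map f) (hσ d) (hσ d') (hn f))
            (retrCod_naturality (K.map f) (hσ d) (hσ d') (hn f)) }
      property := ⟨((leibnizTriple I ⋙ pushTriple ⋙ CartPair.ev01 C).map (K.map f)).property,
        ((pushPair ⋙ leibnizFunctor I).map (K.map f)).property⟩ }
  map_id d := by
    apply WideSubcategory.hom_ext
    apply RetractDiagram.Hom.ext
    · exact congrArg (fun φ => φ.hom) ((K ⋙ pushPair ⋙ leibnizFunctor I).map_id d)
    · exact congrArg (fun φ => φ.hom)
        ((K ⋙ leibnizTriple I ⋙ pushTriple ⋙ CartPair.ev01 C).map_id d)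
  map_comp f g := by
    apply WideSubcategory.hom_ext
    apply RetractDiagram.Hom.ext
    · exact congrArg (fun φ => φ.hom) ((K ⋙ pushPair ⋙ leibnizFunctor I).map_comp f g)
    · exact congrArg (fun φ => φ.hom)
        ((K ⋙ leibnizTriple I ⋙ pushTriple ⋙ CartPair.ev01 C).map_comp f g)

end RetractFunctor

/-! ### Structured fibrations and their pushforward -/

section Frobenius

variable {C : Type u} [Category.{v} C] {TFib : Type u₁} [Category.{v₁} TFib] {U : TFib ⥤ Arrow C}
  (hU : IsFibredNotionOfStructure U) [HasTerminal C] [ChosenPullbacks C] [ChosenPushforwards C]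
  (I : C)

/-- The structure of the first arrow of a composable pair of structured fibrations. -/
noncomputable def FibPair.tfib₁ : FibPair hU I ⥤ Cart (U ⋙ Arrow.rightFunc) :=
  StrictPullback.π₁ _ _ ⋙ CategoryTheory.Prod.fst _ _ ⋙ StrictPullback.π₂ _ _

/-- The structure of the second arrow of a composable pair of structured fibrations. -/
noncomputable def FibPair.tfib₂ : FibPair hU I ⥤ Cart (U ⋙ Arrow.rightFunc) :=
  StrictPullback.π₁ _ _ ⋙ CategoryTheory.Prod.snd _ _ ⋙ StrictPullback.π₂ _ _

lemma FibPair.tfib₁_comp :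
    FibPair.tfib₁ hU I ⋙ uCart hU = uFibPair hU I ⋙ CartPair.ev01 C ⋙ leibnizFunctor I := by
  have h₁ := congrArg (fun F => StrictPullback.π₁ ((uFib hU I).prod (uFib hU I))
    ((CartPair.ev01 C).prod' (CartPair.ev12 C)) ⋙ CategoryTheory.Prod.fst _ _ ⋙ F)
    (StrictPullback.π₁_comp (leibnizFunctor I) (uCart hU))
  have h₂ := congrArg (fun F => F ⋙ CategoryTheory.Prod.fst _ _ ⋙ leibnizFunctor I)
    (StrictPullback.π₁_comp ((uFib hU I).prod (uFib hU I))
      ((CartPair.ev01 C).prod' (CartPair.ev12 C)))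
  exact h₁.symm.trans h₂

lemma FibPair.tfib₂_comp :
    FibPair.tfib₂ hU I ⋙ uCart hU = uFibPair hU I ⋙ CartPair.ev12 C ⋙ leibnizFunctor I := by
  have h₁ := congrArg (fun F => StrictPullback.π₁ ((uFib hU I).prod (uFib hU I))
    ((CartPair.ev01 C).prod' (CartPair.ev12 C)) ⋙ CategoryTheory.Prod.snd _ _ ⋙ F)
    (StrictPullback.π₁_comp (leibnizFunctor I) (uCart hU))
  have h₂ := congrArg (fun F => F ⋙ CategoryTheory.Prod.snd _ _ ⋙ leibnizFunctor I)
    (StrictPullback.π₁_comp ((uFib hU I).prod (uFib hU I))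
      ((CartPair.ev01 C).prod' (CartPair.ev12 C)))
  exact h₁.symm.trans h₂

lemma isDiscreteFibration_uFib : IsDiscreteFibration (uFib hU I) :=
  StrictPullback.isDiscreteFibration_π₁ _ hU.isDiscreteFibration

lemma isDiscreteFibration_uFibPair : IsDiscreteFibration (uFibPair hU I) :=
  StrictPullback.isDiscreteFibration_π₂ _
    ((isDiscreteFibration_uFib hU I).prod (isDiscreteFibration_uFib hU I))

lemma allCartesian_uFib_cod : AllCartesian (uFib hU I ⋙ CartArrow.cod C) :=
  (isDiscreteFibration_uFib hU I).allCartesian.comp (CartArrow.allCartesian_cod C)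

/-- The pushforward of a structured fibration along a structured fibration is a structured
fibration. -/
lemma exists_pushforward_fib (tf1 : HasStableSections hU) (tf2 : HasPushforwardLift hU)
    (tf3 : HasRetractLift hU) :
    ∃ P : FibPair hU I ⥤ FibCart hU I, P ⋙ uFib hU I = uFibPair hU I ⋙ pushPair := by
  obtain ⟨s, hs⟩ := tf1
  obtain ⟨L, hL⟩ := tf2
  obtain ⟨M, hM⟩ := tf3
  -- (TF1) for the structure of `p`: sections of `δ ⇒ p`, natural in the pair.
  obtain ⟨σ, hσ, hn⟩ := exists_natural_section (FibPair.tfib₂ hU I ⋙ s)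
    ((congrArg (fun F => FibPair.tfib₂ hU I ⋙ F) hs).trans (FibPair.tfib₂_comp hU I))
  let R : FibPair hU I ⥤ CartRetract C := leibnizRetractFunctor (uFibPair hU I) σ hσ hn
  -- (TF2) for the structure of `q`, on the triple of `δ ⇒ q`, the projection of its codomain to
  -- `A^I × I`, and `p^I × I`.
  let N : FibPair hU I ⥤ StrictPullback (uCart hU) (CartPair.ev01 C) :=
    StrictPullback.lift (F := uCart hU) (G := CartTriple.ev01 C) (FibPair.tfib₁ hU I)
      (uFibPair hU I ⋙ leibnizTriple I) (FibPair.tfib₁_comp hU I) ⋙ L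
  -- The center of the retract diagram is the arrow underlying the structured trivial fibration
  -- obtained from (TF2).
  have hN : R ⋙ CartRetract.evCenter C = (N ⋙ StrictPullback.π₁ _ _) ⋙ uCart hU := by
    have h₁ := congrArg (fun F => N ⋙ F) (StrictPullback.π₁_comp (uCart hU) (CartPair.ev01 C))
    have h₂ := congrArg (fun F => StrictPullback.lift (F := uCart hU) (G := CartTriple.ev01 C)
      (FibPair.tfib₁ hU I) (uFibPair hU I ⋙ leibnizTriple I) (FibPair.tfib₁_comp hU I) ⋙ F ⋙
        CartPair.ev01 C) hL
    exact (h₁.trans h₂).symm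
  -- (TF3) equips the retract `δ ⇒ p_* q` with a structure; together with `p_* q` itself, this is an
  -- object of the strict pullback that defines `Fib_cart`.
  exact ⟨StrictPullback.lift (uFibPair hU I ⋙ pushPair)
    (StrictPullback.lift R (N ⋙ StrictPullback.π₁ _ _) hN ⋙ M)
    (congrArg (fun F => StrictPullback.lift R (N ⋙ StrictPullback.π₁ _ _) hN ⋙ F) hM).symm, rfl⟩

end Frobenius

end StructuredFrobenius

theorem mainTheorem4 {C : Type*} [Category* C] [HasTerminal C] [ChosenPullbacks C]
    [ChosenPushforwards C] (I : C) {TFib : Type*} [Category* TFib] (U : TFib ⥤ Arrow C)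
    (tf0 : IsFibredNotionOfStructure U)
    (tf1 : HasStableSections tf0)
    (tf2 : HasPushforwardLift tf0)
    (tf3 : HasRetractLift tf0) :
    IsDiscreteFibration (uFib tf0 I) ∧
    (uFib tf0 I ⋙ CartArrow.cod C).IsFibered ∧
    (uFibPair tf0 I ⋙ CartPair.cod C).IsFibered ∧
    ∃ P : FibPair tf0 I ⥤ FibCart tf0 I,
      P ⋙ uFib tf0 I = uFibPair tf0 I ⋙ pushPair ∧
      IsCartesianFunctor (uFibPair tf0 I ⋙ CartPair.cod C) (uFib tf0 I ⋙ CartArrow.cod C) P := by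
  have h := isDiscreteFibration_uFib tf0 I
  have h' := isDiscreteFibration_uFibPair tf0 I
  refine ⟨h, ?_, ?_, ?_⟩
  · exact (allCartesian_uFib_cod tf0 I).isFibered (h.hasLifts.comp (CartArrow.hasLifts_cod C))
  · exact (h'.allCartesian.comp (CartPair.allCartesian_cod C)).isFibered
      (h'.hasLifts.comp (CartPair.hasLifts_cod C))
  · obtain ⟨P, hP⟩ := exists_pushforward_fib tf0 I tf1 tf2 tf3
    -- The codomain of `p_* q` is that of `p`, so `P` lies over the base; cartesian arrows are
    -- preserved because every arrow of the target is cartesian.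
    exact ⟨P, hP, congrArg (fun F => F ⋙ CartArrow.cod C) hP,
      fun φ _ => (allCartesian_uFib_cod tf0 I).cartesianArrows (P.map φ)⟩
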